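/- A Weil algebra is a commutative, associative, unital real algebra $\mathbf A$ of finite dimension $l$ that is local, with nilpotent maximal ideal and residue field $\mathbb R$; let $\mathrm{pr}_{\mathbb R}:\mathbf A\to\mathbb R$ be the projection. For a smooth ($C^\infty$, Hausdorff, second countable) manifold $M$ of dimension $n$, the Weil bundle $M^{\mathbf A}$ is the set of all $\mathbf A$-points of $M$, i.e. of the $\mathbb R$-algebra homomorphisms $\zeta:C^\infty(M)\to\mathbf A$ over points $x\in M$, meaning that $\mathrm{pr}_{\mathbb R}(\zeta(f))=f(x)$ for all $f\in C^\infty(M)$; put $\tilde\pi_M(\zeta)=x$. It carries the coarsest topology for which all maps $\zeta\mapsto\zeta(f)\in\mathbf A$, $f\in C^\infty(M)$, are continuous. A chart $(U,\varphi=(x^1,\dots,x^n))$ of $M$ and a basis $(a_k)_{k}$ of $\mathbf A$ define on $\tilde\pi_M^{-1}(U)$ the map $\varphi^{\mathbf A}=(x^{i,k})_{i,k}$ into $\mathbb R^{nl}$, where $\zeta(x^i)=\sum_k x^{i,k}(\zeta)\,a_k$ (here $\zeta(x^i)$ means $\zeta(f)$ for any $f\in C^\infty(M)$ that equals $x^i$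 near $\tilde\pi_M(\zeta)$). A smooth map $f:M\to N$ induces $f^{\mathbf A}:M^{\mathbf A}\to N^{\mathbf A}$, $\zeta\mapsto\zeta\circ f^*$. An orientation of a smooth manifold is a maximal atlas of smooth charts whose transition maps have positive Jacobian determinants; these charts are called positive. **Theorem E.** Let $M$ be an oriented smooth manifold of dimension $n$, let $\mathbf A$ be a Weil algebra of dimension $l$, and let $(a_k)$ be a basis of $\mathbf A$. The space $M^{\mathbf A}$ is Hausdorff and second countable, and the maps $\varphi^{\mathbf A}$, for all smooth charts $\varphi$ of $M$, are the charts of a smooth atlas on it, which makes $M^{\mathbf A}$ a smooth manifold of dimension $nl$. This manifold is canonically orientable: 1. There is exactly one orientation of $M^{\mathbf A}$ for which $\varphi^{\mathbf A}$ is a positive chart for every positive chart $\varphi$ of $M$. 2. This orientation depends on the basis of $\mathbf A$ only through the orientation that the basis induces on the real vector space $\mathbf A^n$: if a second basis of $\mathbf A$ is obtained from the first by a change of basis of determinant $d$ with $d^n>0$, then the transition maps between the charts $\varphi^{\mathbf A}$ formed with the first basis and the charts $\psi^{\mathbf A}$ formed with the second, for positive charts $\varphi,\psi$ of $M$, are smooth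 with positive Jacobian determinant. 3. It is natural: if $N$ is another oriented smooth manifold of dimension $n$ and $f:M\to N$ is a smooth map whose Jacobian determinants in positive charts of $M$ and $N$ are all positive, then $f^{\mathbf A}:M^{\mathbf A}\to N^{\mathbf A}$, in the charts $\varphi^{\mathbf A}$ and $\psi^{\mathbf A}$ for positive charts $\varphi$ of $M$ and $\psi$ of $N$ (formed with the same basis of $\mathbf A$), is smooth with positive Jacobian determinant. -/

import Mathlib

open scoped Manifold ContDiff Topology

/-- A Weil algebra: a commutative associative unital real algebra of finite dimension which is
local, whose residue field is `ℝ`, and whose maximal ideal is nilpotent. -/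
class WeilAlgebra (A : Type*) [CommRing A] [Algebra ℝ A] : Prop extends IsLocalRing A where
  finite : Module.Finite ℝ A
  residue_bijective : Function.Bijective (algebraMap ℝ (IsLocalRing.ResidueField A))
  nilpotent : ∃ k : ℕ, 1 ≤ k ∧ IsLocalRing.maximalIdeal A ^ k = ⊥

/-- The projection `A → A / 𝔪 ≅ ℝ` of a Weil algebra onto its real part. -/
noncomputable def WeilAlgebra.realPart (A : Type*) [CommRing A] [Algebra ℝ A] [WeilAlgebra A] :
    A →ₐ[ℝ] ℝ :=
  ((AlgEquiv.ofBijective (Algebra.ofId ℝ (IsLocalRing.ResidueField A))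
      WeilAlgebra.residue_bijective).symm : IsLocalRing.ResidueField A →ₐ[ℝ] ℝ).comp
    (IsScalarTower.toAlgHom ℝ A (IsLocalRing.ResidueField A))

/-- The Weil bundle `M^A` of an `n`-dimensional smooth manifold `M`: its elements are the
`A`-points of `M`, that is, the pairs of a point `x` of `M` and a homomorphism of real algebras
`C^∞(M) → A` whose composition with the real part `A → ℝ` is the evaluation at `x`. -/
structure WeilBundle (n : ℕ) (M : Type*) [TopologicalSpace M]
    [ChartedSpace (EuclideanSpace ℝ (Fin n)) M] (A : Type*) [CommRing A] [Algebra ℝ A]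
    [WeilAlgebra A] where
  /-- the algebra homomorphism -/
  hom : C^∞⟮𝓡 n, M; ℝ⟯ →ₐ[ℝ] A
  /-- the projection to `M` -/
  base : M
  realPart_hom : ∀ f : C^∞⟮𝓡 n, M; ℝ⟯, WeilAlgebra.realPart A (hom f) = f base

namespace WeilBundle

variable {n : ℕ} {M : Type*} [TopologicalSpace M] [ChartedSpace (EuclideanSpace ℝ (Fin n)) M]
  {N : Type*} [TopologicalSpace N] [ChartedSpace (EuclideanSpace ℝ (Fin n)) N]
  {A : Type*} [CommRing A] [Algebra ℝ A] [WeilAlgebra A]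

/-- The topology of the Weil bundle: the coarsest one for which all the functions
`ζ ↦ ζ(f) ∈ A`, for `f ∈ C^∞(M)`, are continuous, where the finite-dimensional real vector space
`A` has its usual topology (the coarsest one that makes its linear forms continuous). -/
noncomputable instance : TopologicalSpace (WeilBundle n M A) :=
  ⨅ (f : C^∞⟮𝓡 n, M; ℝ⟯) (l : A →ₗ[ℝ] ℝ),
    TopologicalSpace.induced (fun ζ : WeilBundle n M A => l (ζ.hom f)) inferInstance

/-- The map `f^A : M^A → N^A`, `ζ ↦ ζ ∘ f^*`, induced by a smooth map `f : M → N`. -/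
noncomputable def map (f : C^∞⟮𝓡 n, M; 𝓡 n, N⟯) (ζ : WeilBundle n M A) : WeilBundle n N A where
  hom := ζ.hom.comp
    { toFun := fun g => g.comp f
      map_one' := rfl
      map_mul' := fun _ _ => rfl
      map_zero' := rfl
      map_add' := fun _ _ => rfl
      commutes' := fun _ => rfl }
  base := f ζ.base
  realPart_hom := fun g => ζ.realPart_hom (g.comp f)

open Classical in
/-- The value `ζ(g)` of an `A`-point `ζ` over `x` at a real function `g` that is defined and smooth
near `x` only: it is the value of `ζ` at any smooth function on `M` that agrees with `g` near `x`
(see `WeilBundle.eval_eq` and `WeilBundle.exists_eventuallyEq`). -/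
noncomputable def eval (ζ : WeilBundle n M A) (g : M → ℝ) : A :=
  if h : ∃ f : C^∞⟮𝓡 n, M; ℝ⟯, (f : M → ℝ) =ᶠ[𝓝 ζ.base] g then ζ.hom h.choose else 0

/-- `ζ(f)` depends on the germ of `f` at the base point of `ζ` only. -/
theorem hom_congr [T2Space M] [IsManifold (𝓡 n) ∞ M] (ζ : WeilBundle n M A)
    {f g : C^∞⟮𝓡 n, M; ℝ⟯} (h : (f : M → ℝ) =ᶠ[𝓝 ζ.base] g) : ζ.hom f = ζ.hom g := by
  obtain ⟨χ, hχ⟩ := ((SmoothBumpFunction.nhds_basis_tsupport (I := 𝓡 n) ζ.base).mem_iff.1 h)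
  let c : C^∞⟮𝓡 n, M; ℝ⟯ := ⟨χ, χ.contMDiff⟩
  have hc : (f - g) * c = 0 := by
    ext y
    by_cases hy : y ∈ tsupport χ
    · have : f y = g y := hχ.2 hy
      simp [this]
    · have : c y = 0 := image_eq_zero_of_notMem_tsupport hy
      simp [this]
  have h1 : IsUnit (ζ.hom c) := by
    by_contra hu
    have hm : ζ.hom c ∈ IsLocalRing.maximalIdeal A := hu
    have h0 : IsNilpotent (ζ.hom c) := by
      obtain ⟨k, -, hk⟩ := WeilAlgebra.nilpotent (A := A)
      refine ⟨k, ?_⟩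
      have := Ideal.pow_mem_pow hm k
      rwa [hk] at this
    have h2 := (h0.map (WeilAlgebra.realPart A)).eq_zero
    rw [ζ.realPart_hom] at h2
    have h3 : c ζ.base = 1 := χ.eq_one
    rw [h3] at h2
    exact one_ne_zero h2
  have h2 : (ζ.hom f - ζ.hom g) * ζ.hom c = 0 := by
    rw [← map_sub, ← map_mul, hc, map_zero]
  exact sub_eq_zero.1 (h1.mul_left_eq_zero.1 h2)

theorem eval_eq [T2Space M] [IsManifold (𝓡 n) ∞ M] (ζ : WeilBundle n M A) {g : M → ℝ}
    (f : C^∞⟮𝓡 n, M; ℝ⟯) (h : (f : M → ℝ) =ᶠ[𝓝 ζ.base] g) : ζ.eval g = ζ.hom f := by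
  have h' : ∃ f : C^∞⟮𝓡 n, M; ℝ⟯, (f : M → ℝ) =ᶠ[𝓝 ζ.base] g := ⟨f, h⟩
  rw [eval, dif_pos h']
  exact ζ.hom_congr (h'.choose_spec.trans h.symm)

theorem exists_eventuallyEq [T2Space M] [IsManifold (𝓡 n) ∞ M] {U : Set M} (hU : IsOpen U)
    {x : M} (hx : x ∈ U) {g : M → ℝ} (hg : ContMDiffOn (𝓡 n) 𝓘(ℝ) ∞ g U) :
    ∃ f : C^∞⟮𝓡 n, M; ℝ⟯, (f : M → ℝ) =ᶠ[𝓝 x] g := by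
  obtain ⟨χ, hχ⟩ := ((SmoothBumpFunction.nhds_basis_tsupport (I := 𝓡 n) x).mem_iff.1
    (hU.mem_nhds hx))
  refine ⟨⟨fun y => χ y * g y, ?_⟩, ?_⟩
  · refine contMDiff_of_tsupport fun y hy => ?_
    have hy' : y ∈ tsupport χ := closure_mono (Function.support_mul_subset_left χ g) hy
    exact χ.contMDiff.contMDiffAt.mul (hg.contMDiffAt (hU.mem_nhds (hχ.2 hy')))
  · filter_upwards [χ.eventuallyEq_one] with y hy
    have : χ y = 1 := hy
    simp [this]

/-- The coordinates `x^{i,k}` on the Weil bundle that come from a chart `φ = (x^1, …, x^n)` of `M`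
and a basis `(a_k)` of `A`: they are defined by `ζ(x^i) = ∑ₖ x^{i,k}(ζ) a_k`. -/
noncomputable def coord {κ : Type*} (b : Module.Basis κ ℝ A)
    (φ : OpenPartialHomeomorph M (EuclideanSpace ℝ (Fin n))) (ζ : WeilBundle n M A) :
    EuclideanSpace ℝ (Fin n × κ) :=
  WithLp.toLp 2 fun p => b.repr (ζ.eval fun y => φ y p.1) p.2

/-- `e` is the chart `φ^A` of the Weil bundle induced by the chart `φ` of `M`, in real coordinates:
its domain is the preimage of the domain of `φ`, and it is given there by the coordinates
`x^{i,k}`. -/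
def IsLift {κ : Type*} [Fintype κ] (b : Module.Basis κ ℝ A)
    (φ : OpenPartialHomeomorph M (EuclideanSpace ℝ (Fin n)))
    (e : OpenPartialHomeomorph (WeilBundle n M A) (EuclideanSpace ℝ (Fin n × κ))) : Prop :=
  e.source = base ⁻¹' φ.source ∧ Set.EqOn e (coord b φ) e.source

/-- The set of the charts `φ^A` of the Weil bundle, for `φ` in a set `𝒜` of charts of `M`. -/
def lifts {κ : Type*} [Fintype κ] (b : Module.Basis κ ℝ A)
    (𝒜 : Set (OpenPartialHomeomorph M (EuclideanSpace ℝ (Fin n)))) :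
    Set (OpenPartialHomeomorph (WeilBundle n M A) (EuclideanSpace ℝ (Fin n × κ))) :=
  {e | ∃ φ ∈ 𝒜, IsLift b φ e}

end WeilBundle

/-- The local expression of `f : X → Y` in the charts `e` of `X` and `e'` of `Y` is smooth with
positive Jacobian determinant. For `X = Y` and `f = id` this says that the change of charts from
`e` to `e'` is smooth with positive Jacobian determinant. -/
def IsPositiveInCharts {ι X Y : Type*} [Fintype ι] [TopologicalSpace X] [TopologicalSpace Y]
    (e : OpenPartialHomeomorph X (EuclideanSpace ℝ ι)) (f : X → Y)
    (e' : OpenPartialHomeomorph Y (EuclideanSpace ℝ ι)) : Prop :=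
  ContDiffOn ℝ ∞ (e' ∘ f ∘ e.symm) (e.target ∩ e.symm ⁻¹' (f ⁻¹' e'.source)) ∧
    ∀ v ∈ e.target ∩ e.symm ⁻¹' (f ⁻¹' e'.source), 0 < (fderiv ℝ (e' ∘ f ∘ e.symm) v).det

/-- An orientation of a smooth manifold: a maximal atlas of smooth charts with positive Jacobian
determinants of the changes of charts. -/
structure SmoothOrientation (ι X : Type*) [Fintype ι] [TopologicalSpace X]
    [ChartedSpace (EuclideanSpace ℝ ι) X] where
  /-- the positively oriented charts -/
  charts : Set (OpenPartialHomeomorph X (EuclideanSpace ℝ ι))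
  subset_maximalAtlas : charts ⊆ IsManifold.maximalAtlas 𝓘(ℝ, EuclideanSpace ℝ ι) ∞ X
  cover : ∀ x : X, ∃ e ∈ charts, x ∈ e.source
  positive : ∀ e ∈ charts, ∀ e' ∈ charts, IsPositiveInCharts e id e'
  maximal : ∀ e ∈ IsManifold.maximalAtlas 𝓘(ℝ, EuclideanSpace ℝ ι) ∞ X,
    (∀ e' ∈ charts, IsPositiveInCharts e id e') → e ∈ charts

/-!
The Weil bundle is analysed through the prolongation of smooth functions to Weil algebras. For a
smooth function `f` of `n` real variables, `f^A : Aⁿ → A` is defined at `x + ν`, with `x ∈ ℝⁿ` and `ν`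
nilpotent, by the Taylor expansion of `f` at `x` evaluated at `ν`. This finite sum is the exponential
of the nilpotent derivation `∑ᵢ νᵢ ∂ᵢ`, so `f ↦ f^A(a)` is a homomorphism of algebras
(`WeilAlgebra.prolong_mul`); and `f^A` is smooth, with the `A`-linear derivative
`h ↦ ∑ᵢ (∂ᵢ f)^A(a) hᵢ` (`WeilAlgebra.hasFDerivAt_prolong`).

By Hadamard's lemma, two `A`-points with the same values at the coordinate functions of a chart have
values at any `f` that agree modulo every power of the nilpotent maximal ideal, so they are equal
(`WeilBundle.ext_of_coordPoint`). Together with the prolongation this gives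
`ζ(f) = (f ∘ φ⁻¹)^A(ζ(x¹), …, ζ(xⁿ))`, which makes `φ^A` a homeomorphism onto an open set, and
shows that the local expression of `f^A : M^A → N^A` is the prolongation of the local expression of
`f` (`WeilBundle.coordPoint_map`). In particular the changes of charts are smooth.

The derivative of a prolongation is multiplication by a matrix `P` over `A` whose real part is the
Jacobian matrix of the original map. Its determinant over `ℝ` is the norm of `det P ∈ A`, and the norm
of an element `a` of a Weil algebra of dimension `l` is the `l`-th power of its real part
(`WeilAlgebra.norm_eq_realPart_pow`). Hence positive Jacobian determinants stay positive
(`WeilAlgebra.det_fderiv_prolongMap_pos`), while a change of basis of `A` of determinant `d`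
contributes the factor `dⁿ` or its inverse. So the lifts of the positive charts form a covering
family with positive changes of charts, and such a family lies in exactly one orientation
(`SmoothOrientation.existsUnique_of_cover`).
-/

/-! ### Weil algebras: norms and determinants -/

namespace WeilAlgebra

/-- A finite-dimensional commutative algebra has a submultiplicative norm: it embeds into the
endomorphisms of a normed space through its regular representation. -/
theorem exists_normedCommRing (A : Type*) [iA : CommRing A] [Algebra ℝ A] [Module.Finite ℝ A] :
    ∃ nc : NormedCommRing A, nc.toCommRing = iA ∧
      ∀ (r : ℝ) (a : A), nc.norm (r • a) ≤ ‖r‖ * nc.norm a := by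
  let b := Module.finBasis ℝ A
  let V := Fin (Module.finrank ℝ A) → ℝ
  let f : A →ₐ[ℝ] (V →L[ℝ] V) :=
    (Module.End.toContinuousLinearMap (𝕜 := ℝ) V : (V →ₗ[ℝ] V) →ₐ[ℝ] (V →L[ℝ] V)).comp
      ((LinearEquiv.conjAlgEquiv ℝ b.equivFun : Module.End ℝ A →ₐ[ℝ] Module.End ℝ V).comp
        (Algebra.lmul ℝ A))
  have hf : Function.Injective f :=
    (Module.End.toContinuousLinearMap (𝕜 := ℝ) V).injective.comp
      ((LinearEquiv.conjAlgEquiv ℝ b.equivFun).injective.comp Algebra.lmul_injective)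
  refine ⟨NormedCommRing.induced A _ f hf, rfl, fun r a => ?_⟩
  change ‖f (r • a)‖ ≤ ‖r‖ * ‖f a‖
  rw [map_smul]
  exact norm_smul_le r (f a)

variable {A : Type*} [CommRing A] [Algebra ℝ A] [WeilAlgebra A]

theorem isNilpotent_of_mem {a : A} (ha : a ∈ IsLocalRing.maximalIdeal A) : IsNilpotent a := by
  obtain ⟨k, -, hk⟩ := nilpotent (A := A)
  refine ⟨k, ?_⟩
  have := Ideal.pow_mem_pow ha k
  rwa [hk] at this

theorem realPart_algebraMap (r : ℝ) : realPart A (algebraMap ℝ A r) = r :=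
  (realPart A).commutes r

theorem mem_maximalIdeal_iff {a : A} : a ∈ IsLocalRing.maximalIdeal A ↔ realPart A a = 0 := by
  refine ⟨fun ha => ((isNilpotent_of_mem ha).map (realPart A)).eq_zero, fun h => ?_⟩
  intro hu
  exact (hu.map (realPart A)).ne_zero h

theorem sub_realPart_mem (a : A) :
    a - algebraMap ℝ A (realPart A a) ∈ IsLocalRing.maximalIdeal A := by
  rw [mem_maximalIdeal_iff, map_sub, realPart_algebraMap, sub_self]

/-- The only eigenvalue of the multiplication by `a` is the real part of `a`. -/
theorem norm_eq_realPart_pow (a : A) :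
    Algebra.norm ℝ a = realPart A a ^ Module.finrank ℝ A := by
  have : Module.Finite ℝ A := WeilAlgebra.finite
  set r := realPart A a
  set ν := algebraMap ℝ A r - a
  have hν : IsNilpotent (Algebra.lmul ℝ A ν) := by
    refine IsNilpotent.map (isNilpotent_of_mem ?_) _
    rw [← neg_mem_iff, neg_sub]
    exact sub_realPart_mem a
  have h := LinearMap.charpoly_eq_X_pow_iff (φ := Algebra.lmul ℝ A ν) |>.2 (by
    intro m
    obtain ⟨k, hk⟩ := hν
    exact ⟨k, by rw [hk]; rfl⟩)
  have h2 := congrArg (Polynomial.eval r) h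
  rw [LinearMap.eval_charpoly] at h2
  simp only [Polynomial.eval_pow, Polynomial.eval_X] at h2
  rw [← h2, Algebra.norm_apply]
  congr 1
  ext x
  simp [ν, Algebra.smul_def, LinearMap.sub_apply, Module.algebraMap_end_apply]

theorem norm_pos {a : A} (ha : 0 < realPart A a) : 0 < Algebra.norm ℝ a := by
  rw [norm_eq_realPart_pow]
  positivity

end WeilAlgebra

/-- A linear form on `ℝⁿ` in terms of its values on the standard basis. -/
theorem clm_apply_eq_sum {n : ℕ} (L : EuclideanSpace ℝ (Fin n) →L[ℝ] ℝ)
    (v : EuclideanSpace ℝ (Fin n)) : L v = ∑ i, v i * L (EuclideanSpace.single i 1) := by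
  conv_lhs => rw [← (EuclideanSpace.basisFun (Fin n) ℝ).sum_repr v]
  simp

/-! ### Hadamard's lemma -/

section Hadamard

variable {E : Type} [NormedAddCommGroup E] [NormedSpace ℝ E] [ProperSpace E]

/-- Differentiation under the integral sign over a compact interval. -/
theorem hasFDerivAt_integral_of_contDiff {G : Type} [NormedAddCommGroup G] [NormedSpace ℝ G]
    [CompleteSpace G] {F : E × ℝ → G} (hF : ContDiff ℝ 1 F) (x : E) :
    HasFDerivAt (fun y => ∫ t in (0 : ℝ)..1, F (y, t))
      (∫ t in (0 : ℝ)..1, (fderiv ℝ F (x, t)).comp (ContinuousLinearMap.inl ℝ E ℝ)) x := by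
  have hc : Continuous fun p : E × ℝ => (fderiv ℝ F p).comp (ContinuousLinearMap.inl ℝ E ℝ) :=
    (hF.continuous_fderiv one_ne_zero).clm_comp continuous_const
  obtain ⟨C, hC⟩ := ((isCompact_closedBall x 1).prod (isCompact_Icc (a := (0 : ℝ)) (b := 1)))
    |>.exists_bound_of_continuousOn hc.continuousOn
  refine intervalIntegral.hasFDerivAt_integral_of_dominated_of_fderiv_le (bound := fun _ => C)
    (s := Metric.closedBall x 1)
    (F' := fun y t => (fderiv ℝ F (y, t)).comp (ContinuousLinearMap.inl ℝ E ℝ))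
    (Metric.closedBall_mem_nhds x one_pos) ?_ ?_ ?_ ?_ ?_ ?_
  · exact .of_forall fun y =>
      (hF.continuous.comp (Continuous.prodMk_right y)).aestronglyMeasurable
  · exact (hF.continuous.comp (Continuous.prodMk_right x)).intervalIntegrable _ _
  · exact (hc.comp (Continuous.prodMk_right x)).aestronglyMeasurable
  · refine .of_forall fun t ht y hy => hC (y, t) ⟨hy, ?_⟩
    rw [Set.uIoc_of_le zero_le_one] at ht
    exact Set.Ioc_subset_Icc_self ht
  · simp
  · refine .of_forall fun t _ y _ => ?_
    exact ((hF.differentiable one_ne_zero) (y, t)).hasFDerivAt.comp y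
      (hasFDerivAt_prodMk_left y t)

/-- The order of differentiability is a natural number, for an induction in which the codomain `G`
is replaced by the space of linear maps into it. -/
theorem contDiff_integral_of_contDiff (m : ℕ) :
    ∀ {G : Type} [NormedAddCommGroup G] [NormedSpace ℝ G] [CompleteSpace G] {F : E × ℝ → G},
      ContDiff ℝ ∞ F → ContDiff ℝ m fun y => ∫ t in (0 : ℝ)..1, F (y, t) := by
  induction m with
  | zero =>
    intro G _ _ _ F hF
    refine contDiff_zero.2 (continuous_iff_continuousAt.2 fun x => ?_)
    exact (hasFDerivAt_integral_of_contDiff (hF.of_le (by simp)) x).continuousAt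
  | succ m ih =>
    intro G _ _ _ F hF
    have hd := hasFDerivAt_integral_of_contDiff (hF.of_le (by simp : (1 : ℕ∞ω) ≤ ∞))
    push_cast
    refine contDiff_succ_iff_fderiv.2 ⟨fun x => (hd x).differentiableAt, by simp, ?_⟩
    have : fderiv ℝ (fun y => ∫ t in (0 : ℝ)..1, F (y, t)) = fun x =>
        ∫ t in (0 : ℝ)..1, (fderiv ℝ F (x, t)).comp (ContinuousLinearMap.inl ℝ E ℝ) :=
      funext fun x => (hd x).fderiv
    rw [this]
    refine ih (F := fun p => (fderiv ℝ F p).comp (ContinuousLinearMap.inl ℝ E ℝ)) ?_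
    exact (hF.fderiv_right (by simp)).clm_comp contDiff_const

/-- Hadamard's lemma: a smooth function on `ℝⁿ` that vanishes at `c` is a combination of the
coordinates centred at `c` with smooth coefficients. -/
theorem exists_hadamard {n : ℕ} {f : EuclideanSpace ℝ (Fin n) → ℝ} (hf : ContDiff ℝ ∞ f)
    (c : EuclideanSpace ℝ (Fin n)) :
    ∃ g : Fin n → EuclideanSpace ℝ (Fin n) → ℝ, (∀ i, ContDiff ℝ ∞ (g i)) ∧
      ∀ y, f y = f c + ∑ i, (y i - c i) * g i y := by
  let K (i : Fin n) (p : EuclideanSpace ℝ (Fin n) × ℝ) : ℝ :=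
    fderiv ℝ f (c + p.2 • (p.1 - c)) (EuclideanSpace.single i 1)
  have hK : ∀ i, ContDiff ℝ ∞ (K i) := fun i => by
    refine ContDiff.clm_apply ((hf.fderiv_right (m := ∞) (by simp)).comp ?_) contDiff_const
    exact contDiff_const.add (contDiff_snd.smul (contDiff_fst.sub contDiff_const))
  refine ⟨fun i y => ∫ t in (0 : ℝ)..1, K i (y, t),
    fun i => contDiff_infty.2 fun m => contDiff_integral_of_contDiff m (hK i), fun y => ?_⟩
  have hd : ∀ t : ℝ, HasDerivAt (fun t : ℝ => f (c + t • (y - c)))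
      (∑ i, (y i - c i) * K i (y, t)) t := fun t => by
    have h1 : HasDerivAt (fun t : ℝ => c + t • (y - c)) (y - c) t := by
      simpa using ((hasDerivAt_id t).smul_const (y - c)).const_add c
    have h2 := ((hf.differentiable (by simp)) (c + t • (y - c))).hasFDerivAt.comp_hasDerivAt t h1
    rw [clm_apply_eq_sum] at h2
    exact h2
  have hint := intervalIntegral.integral_eq_sub_of_hasDerivAt (a := 0) (b := 1)
    (fun t _ => hd t) (Continuous.intervalIntegrable (by
      refine continuous_finsetSum _ fun i _ => continuous_const.mul ?_
      exact (hK i).continuous.comp (Continuous.prodMk_right y)) _ _)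
  rw [intervalIntegral.integral_finsetSum] at hint
  · simp only [intervalIntegral.integral_const_mul, one_smul, zero_smul, add_zero,
      add_sub_cancel] at hint
    linarith
  · intro i _
    exact (continuous_const.mul
      ((hK i).continuous.comp (Continuous.prodMk_right y))).intervalIntegrable _ _

end Hadamard

/-! ### Taylor terms with values in an algebra -/

section PartialDerivatives

variable {n : ℕ}

/-- The `i`-th partial derivative of a function on `ℝⁿ`. -/
noncomputable def partialDeriv (i : Fin n) (f : EuclideanSpace ℝ (Fin n) → ℝ) :
    EuclideanSpace ℝ (Fin n) → ℝ :=
  fun x => fderiv ℝ f x (EuclideanSpace.single i 1)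

variable {f g : EuclideanSpace ℝ (Fin n) → ℝ} {x : EuclideanSpace ℝ (Fin n)}

theorem partialDeriv_congr (i : Fin n) (h : f =ᶠ[𝓝 x] g) :
    partialDeriv i f =ᶠ[𝓝 x] partialDeriv i g :=
  h.fderiv.fun_comp fun L => L (EuclideanSpace.single i 1)

theorem ContDiffAt.partialDeriv (i : Fin n) (hf : ContDiffAt ℝ ∞ f x) :
    ContDiffAt ℝ ∞ (partialDeriv i f) x :=
  (hf.fderiv_right (by simp)).clm_apply contDiffAt_const

theorem ContDiffOn.partialDeriv {U : Set (EuclideanSpace ℝ (Fin n))} (hU : IsOpen U) (i : Fin n)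
    (hf : ContDiffOn ℝ ∞ f U) : ContDiffOn ℝ ∞ (partialDeriv i f) U := fun _ hy =>
  ((hf.contDiffAt (hU.mem_nhds hy)).partialDeriv i).contDiffWithinAt

theorem ContDiffAt.eventually_differentiableAt (hf : ContDiffAt ℝ ∞ f x) :
    ∀ᶠ y in 𝓝 x, DifferentiableAt ℝ f y := by
  filter_upwards [(hf.of_le (by simp : (1 : ℕ∞ω) ≤ ∞)).eventually (by simp)] with y hy
  exact hy.differentiableAt one_ne_zero

theorem partialDeriv_add (i : Fin n) (hf : ContDiffAt ℝ ∞ f x) (hg : ContDiffAt ℝ ∞ g x) :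
    partialDeriv i (f + g) =ᶠ[𝓝 x] partialDeriv i f + partialDeriv i g := by
  filter_upwards [hf.eventually_differentiableAt, hg.eventually_differentiableAt] with y h1 h2
  simp [partialDeriv, fderiv_add h1 h2]

theorem partialDeriv_mul (i : Fin n) (hf : ContDiffAt ℝ ∞ f x) (hg : ContDiffAt ℝ ∞ g x) :
    partialDeriv i (f * g) =ᶠ[𝓝 x] partialDeriv i f * g + f * partialDeriv i g := by
  filter_upwards [hf.eventually_differentiableAt, hg.eventually_differentiableAt] with y h1 h2
  simp only [partialDeriv, fderiv_mul h1 h2, add_apply,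
    smul_apply, smul_eq_mul, Pi.add_apply, Pi.mul_apply]
  ring

theorem partialDeriv_comm (i j : Fin n) (hf : ContDiffAt ℝ ∞ f x) :
    partialDeriv i (partialDeriv j f) =ᶠ[𝓝 x] partialDeriv j (partialDeriv i f) := by
  filter_upwards [(hf.of_le (WithTop.coe_le_coe.2 le_top : (2 : ℕ∞ω) ≤ ∞)).eventually (by simp)]
    with y hy
  have hs : IsSymmSndFDerivAt ℝ f y := hy.isSymmSndFDerivAt
    (minSmoothness_of_isRCLikeNormedField).le
  have hd : DifferentiableAt ℝ (fderiv ℝ f) y :=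
    (hy.fderiv_right (m := 1) (by norm_num)).differentiableAt one_ne_zero
  have key : ∀ k l, partialDeriv k (partialDeriv l f) y =
      fderiv ℝ (fderiv ℝ f) y (EuclideanSpace.single k 1) (EuclideanSpace.single l 1) := by
    intro k l
    unfold partialDeriv
    rw [fderiv_clm_apply hd (differentiableAt_const _)]
    simp
  rw [key, key, hs.eq]

theorem partialDeriv_const (i : Fin n) (c : ℝ) :
    partialDeriv i (fun _ : EuclideanSpace ℝ (Fin n) => c) = fun _ => 0 := by
  ext y
  simp [partialDeriv]

theorem partialDeriv_coord (i j : Fin n) :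
    partialDeriv i (fun y : EuclideanSpace ℝ (Fin n) => y j) = fun _ => if i = j then 1 else 0 := by
  ext y
  have : HasFDerivAt (fun y : EuclideanSpace ℝ (Fin n) => y j)
    (EuclideanSpace.proj j : EuclideanSpace ℝ (Fin n) →L[ℝ] ℝ) y :=
    (EuclideanSpace.proj j : EuclideanSpace ℝ (Fin n) →L[ℝ] ℝ).hasFDerivAt
  rw [partialDeriv, this.fderiv]
  simp [eq_comm]

end PartialDerivatives

section TaylorTerm

variable {n : ℕ} {A : Type*} [CommRing A] [Algebra ℝ A]

/-- The homogeneous part `∑_{|α| = j} ∂^α f(x) ν^α / α!` of degree `j` of the Taylor expansion of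
`f` at `x`, evaluated at elements `ν` of an algebra. The recursion is
`(j + 1) T_{j+1} f = ∑ᵢ νᵢ T_j (∂ᵢ f)`, which says that `∑ⱼ T_j` is the exponential of the
derivation `∑ᵢ νᵢ ∂ᵢ`. -/
noncomputable def taylorTerm : ℕ → (EuclideanSpace ℝ (Fin n) → ℝ) → EuclideanSpace ℝ (Fin n) →
    (Fin n → A) → A
  | 0, f, x, _ => algebraMap ℝ A (f x)
  | j + 1, f, x, ν => ((j + 1 : ℝ)⁻¹) • ∑ i, ν i * taylorTerm j (partialDeriv i f) x ν

/-- The term of degree `j - 1` of the Taylor expansion, which is `0` for `j = 0`. -/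
noncomputable def taylorTermPred (j : ℕ) (f : EuclideanSpace ℝ (Fin n) → ℝ)
    (x : EuclideanSpace ℝ (Fin n)) (ν : Fin n → A) : A :=
  Nat.casesOn j 0 fun j => taylorTerm j f x ν

variable {f g : EuclideanSpace ℝ (Fin n) → ℝ} {x : EuclideanSpace ℝ (Fin n)} (ν : Fin n → A)

theorem succ_smul_taylorTerm (j : ℕ) (f : EuclideanSpace ℝ (Fin n) → ℝ)
    (x : EuclideanSpace ℝ (Fin n)) :
    (j + 1 : ℝ) • taylorTerm (j + 1) f x ν = ∑ i, ν i * taylorTerm j (partialDeriv i f) x ν := by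
  rw [taylorTerm, smul_smul, mul_inv_cancel₀ (by positivity), one_smul]

/-- The recursion, shifted so that it includes the degree `0`. -/
theorem sum_mul_taylorTermPred (j : ℕ) (f : EuclideanSpace ℝ (Fin n) → ℝ)
    (x : EuclideanSpace ℝ (Fin n)) :
    ∑ i, ν i * taylorTermPred j (partialDeriv i f) x ν = (j : ℝ) • taylorTerm j f x ν := by
  cases j with
  | zero => simp [taylorTermPred]
  | succ j =>
    push_cast
    rw [succ_smul_taylorTerm]
    rfl

theorem taylorTerm_congr (j : ℕ) (h : f =ᶠ[𝓝 x] g) : taylorTerm j f x ν = taylorTerm j g x ν := by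
  induction j generalizing f g with
  | zero => simp [taylorTerm, h.eq_of_nhds]
  | succ j ih =>
    simp only [taylorTerm]
    congr 1
    exact Finset.sum_congr rfl fun i _ => by rw [ih (partialDeriv_congr i h)]

theorem taylorTermPred_congr (j : ℕ) (h : f =ᶠ[𝓝 x] g) :
    taylorTermPred j f x ν = taylorTermPred j g x ν := by
  cases j with
  | zero => rfl
  | succ j => exact taylorTerm_congr ν j h

theorem taylorTerm_add (j : ℕ) (hf : ContDiffAt ℝ ∞ f x) (hg : ContDiffAt ℝ ∞ g x) :
    taylorTerm j (f + g) x ν = taylorTerm j f x ν + taylorTerm j g x ν := by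
  induction j generalizing f g with
  | zero => simp [taylorTerm]
  | succ j ih =>
    simp only [taylorTerm]
    rw [← smul_add, ← Finset.sum_add_distrib]
    congr 1
    refine Finset.sum_congr rfl fun i _ => ?_
    rw [taylorTerm_congr ν j (partialDeriv_add i hf hg), ih (hf.partialDeriv i) (hg.partialDeriv i),
      mul_add]

/-- The Leibniz rule for the divided powers of the derivation `∑ᵢ νᵢ ∂ᵢ`. -/
theorem taylorTerm_mul (j : ℕ) (hf : ContDiffAt ℝ ∞ f x) (hg : ContDiffAt ℝ ∞ g x) :
    taylorTerm j (f * g) x ν =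
      ∑ p ∈ Finset.HasAntidiagonal.antidiagonal j, taylorTerm p.1 f x ν * taylorTerm p.2 g x ν := by
  induction j generalizing f g with
  | zero => simp [taylorTerm]
  | succ j ih =>
    have hj : ((j : ℝ) + 1) ≠ 0 := by positivity
    refine smul_right_injective A hj ?_
    change ((j : ℝ) + 1) • _ = ((j : ℝ) + 1) • _
    have h1 : ∀ i, taylorTerm j (partialDeriv i (f * g)) x ν =
        ∑ p ∈ Finset.HasAntidiagonal.antidiagonal j,
          (taylorTerm p.1 (partialDeriv i f) x ν * taylorTerm p.2 g x ν + taylorTerm p.1 f x ν * taylorTerm p.2 (partialDeriv i g) x ν) := fun i => by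
      rw [taylorTerm_congr ν j (partialDeriv_mul i hf hg),
        taylorTerm_add (f := partialDeriv i f * g) (g := f * partialDeriv i g) ν j
          ((hf.partialDeriv i).mul hg) (hf.mul (hg.partialDeriv i)),
        ih (hf.partialDeriv i) hg, ih hf (hg.partialDeriv i), Finset.sum_add_distrib]
    have h2 : ∑ i, ν i * taylorTerm j (partialDeriv i (f * g)) x ν =
        ∑ p ∈ Finset.HasAntidiagonal.antidiagonal j,
          (((p.1 + 1 : ℝ) • taylorTerm (p.1 + 1) f x ν) * taylorTerm p.2 g x ν +
          taylorTerm p.1 f x ν * ((p.2 + 1 : ℝ) • taylorTerm (p.2 + 1) g x ν)) := by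
      simp only [h1, Finset.mul_sum]
      rw [Finset.sum_comm]
      refine Finset.sum_congr rfl fun p _ => ?_
      rw [succ_smul_taylorTerm, succ_smul_taylorTerm, Finset.sum_mul, Finset.mul_sum,
        ← Finset.sum_add_distrib]
      exact Finset.sum_congr rfl fun i _ => by ring
    rw [succ_smul_taylorTerm, h2, Finset.sum_add_distrib]
    have h3 : ∑ p ∈ Finset.HasAntidiagonal.antidiagonal (j + 1),
        ((p.1 : ℝ) • taylorTerm p.1 f x ν) * taylorTerm p.2 g x ν =
        ∑ p ∈ Finset.HasAntidiagonal.antidiagonal j,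
          ((p.1 + 1 : ℝ) • taylorTerm (p.1 + 1) f x ν) * taylorTerm p.2 g x ν := by
      rw [Finset.Nat.sum_antidiagonal_succ]
      simp
    have h4 : ∑ p ∈ Finset.HasAntidiagonal.antidiagonal (j + 1),
        taylorTerm p.1 f x ν * ((p.2 : ℝ) • taylorTerm p.2 g x ν) =
        ∑ p ∈ Finset.HasAntidiagonal.antidiagonal j,
          taylorTerm p.1 f x ν * ((p.2 + 1 : ℝ) • taylorTerm (p.2 + 1) g x ν) := by
      rw [Finset.Nat.sum_antidiagonal_succ']
      simp
    -- weighted by `p.1` and by `p.2`, which add up to `j + 1`, the terms combine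
    rw [← h3, ← h4, ← Finset.sum_add_distrib, Finset.smul_sum]
    refine Finset.sum_congr rfl fun p hp => ?_
    rw [smul_mul_assoc, mul_smul_comm, ← add_smul]
    congr 1
    exact_mod_cast Finset.HasAntidiagonal.mem_antidiagonal.1 hp

theorem taylorTerm_const_succ (j : ℕ) (c : ℝ) :
    taylorTerm (j + 1) (fun _ => c) x ν = 0 := by
  induction j generalizing c with
  | zero => simp [taylorTerm, partialDeriv_const]
  | succ j ih => rw [taylorTerm]; simp [partialDeriv_const, ih]

theorem taylorTerm_coord_one (i : Fin n) : taylorTerm 1 (fun y => y i) x ν = ν i := by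
  simp [taylorTerm, partialDeriv_coord]

theorem taylorTerm_coord_add_two (j : ℕ) (i : Fin n) :
    taylorTerm (j + 2) (fun y => y i) x ν = 0 := by
  rw [taylorTerm]
  simp [partialDeriv_coord, taylorTerm_const_succ]

theorem taylorTerm_mem_pow {I : Ideal A} (hν : ∀ i, ν i ∈ I) (j : ℕ)
    (f : EuclideanSpace ℝ (Fin n) → ℝ) (x : EuclideanSpace ℝ (Fin n)) :
    taylorTerm j f x ν ∈ I ^ j := by
  induction j generalizing f with
  | zero => simp
  | succ j ih =>
    rw [taylorTerm]
    refine Submodule.smul_of_tower_mem _ _ (Ideal.sum_mem _ fun i _ => ?_)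
    rw [pow_succ']
    exact Ideal.mul_mem_mul (hν i) (ih _)

end TaylorTerm

section TaylorCalculus

variable {n : ℕ} {A : Type*} [NormedCommRing A] [NormedAlgebra ℝ A]
  {f : EuclideanSpace ℝ (Fin n) → ℝ}

theorem ContDiffOn.taylorTerm {U : Set (EuclideanSpace ℝ (Fin n))} (hU : IsOpen U) (j : ℕ)
    (hf : ContDiffOn ℝ ∞ f U) :
    ContDiffOn ℝ ∞ (fun p : EuclideanSpace ℝ (Fin n) × (Fin n → A) => taylorTerm j f p.1 p.2)
      (U ×ˢ Set.univ) := by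
  induction j generalizing f with
  | zero =>
    simp only [_root_.taylorTerm]
    exact (Algebra.linearMap ℝ A).toContinuousLinearMap.contDiff.comp_contDiffOn
      (hf.comp contDiffOn_fst fun p hp => hp.1)
  | succ j ih =>
    simp only [_root_.taylorTerm]
    refine (ContDiffOn.sum fun i _ => ?_).const_smul _
    refine ContDiffOn.mul ?_ (ih (hf.partialDeriv hU i))
    exact ((contDiff_apply ℝ A i).comp contDiff_snd).contDiffOn

/-- The derivative of a Taylor term in the centre `x` and in the increment `ν`. -/
theorem hasFDerivAt_taylorTerm (j : ℕ) {x : EuclideanSpace ℝ (Fin n)} (hf : ContDiffAt ℝ ∞ f x)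
    (ν : Fin n → A) :
    HasFDerivAt (fun p : EuclideanSpace ℝ (Fin n) × (Fin n → A) => taylorTerm j f p.1 p.2)
      (∑ i, ((ContinuousLinearMap.mul ℝ A (taylorTerm j (partialDeriv i f) x ν)).comp
          (((Algebra.linearMap ℝ A).toContinuousLinearMap.comp
            (EuclideanSpace.proj i : EuclideanSpace ℝ (Fin n) →L[ℝ] ℝ)).comp
              (ContinuousLinearMap.fst ℝ _ _)) +
        (ContinuousLinearMap.mul ℝ A (taylorTermPred j (partialDeriv i f) x ν)).comp
          ((ContinuousLinearMap.proj i).comp (ContinuousLinearMap.snd ℝ _ (Fin n → A)))))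
      (x, ν) := by
  induction j generalizing f with
  | zero =>
    have h1 : HasFDerivAt (fun p : EuclideanSpace ℝ (Fin n) × (Fin n → A) => f p.1)
        ((fderiv ℝ f x).comp (ContinuousLinearMap.fst ℝ _ _)) (x, ν) :=
      (hf.differentiableAt (by simp)).hasFDerivAt.comp (x, ν) hasFDerivAt_fst
    have h2 := (Algebra.linearMap ℝ A).toContinuousLinearMap.hasFDerivAt.comp (x, ν) h1
    refine h2.congr_fderiv ?_
    ext h
    · simp only [ContinuousLinearMap.comp_apply, ContinuousLinearMap.inl_apply]
      rw [ContinuousLinearMap.coe_fst', clm_apply_eq_sum]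
      simp [taylorTerm, taylorTermPred, partialDeriv, mul_comm]
    · simp [taylorTermPred]
  | succ j ih =>
    have h1 : ∀ i, HasFDerivAt (fun p : EuclideanSpace ℝ (Fin n) × (Fin n → A) => p.2 i)
        ((ContinuousLinearMap.proj i).comp (ContinuousLinearMap.snd ℝ _ (Fin n → A))) (x, ν) :=
      fun i => ((ContinuousLinearMap.proj (R := ℝ) (φ := fun _ : Fin n => A) i).comp
        (ContinuousLinearMap.snd ℝ (EuclideanSpace ℝ (Fin n)) (Fin n → A))).hasFDerivAt
    have h2 := (HasFDerivAt.fun_sum (u := Finset.univ)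
      fun i _ => (h1 i).mul (ih (hf.partialDeriv i))).const_smul ((j + 1 : ℝ)⁻¹)
    refine h2.congr_fderiv ?_
    have hc : ∀ i m, taylorTerm j (partialDeriv m (partialDeriv i f)) x ν =
        taylorTerm j (partialDeriv i (partialDeriv m f)) x ν :=
      fun i m => taylorTerm_congr ν j (partialDeriv_comm m i hf)
    have hc' : ∀ i m, taylorTermPred j (partialDeriv m (partialDeriv i f)) x ν =
        taylorTermPred j (partialDeriv i (partialDeriv m f)) x ν :=
      fun i m => taylorTermPred_congr ν j (partialDeriv_comm m i hf)
    refine ContinuousLinearMap.ext fun ⟨t, η⟩ => ?_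
    simp only [smul_apply, sum_apply,
      add_apply, ContinuousLinearMap.comp_apply, smul_eq_mul,
      ContinuousLinearMap.coe_fst', ContinuousLinearMap.coe_snd', ContinuousLinearMap.proj_apply,
      ContinuousLinearMap.mul_apply', hc, hc']
    have h3 : ∑ i, ν i * ∑ m, (taylorTerm j (partialDeriv i (partialDeriv m f)) x ν *
          algebraMap ℝ A (t m) +
        taylorTermPred j (partialDeriv i (partialDeriv m f)) x ν * η m) =
        ∑ m, (((j : ℝ) + 1) • taylorTerm (j + 1) (partialDeriv m f) x ν * algebraMap ℝ A (t m) +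
          (j : ℝ) • taylorTerm j (partialDeriv m f) x ν * η m) := by
      simp only [succ_smul_taylorTerm, ← sum_mul_taylorTermPred, Finset.mul_sum, Finset.sum_mul,
        ← Finset.sum_add_distrib]
      rw [Finset.sum_comm]
      exact Finset.sum_congr rfl fun m _ => Finset.sum_congr rfl fun i _ => by ring
    have hj : ((j : ℝ) + 1) ≠ 0 := by positivity
    rw [inv_smul_eq_iff₀ hj, Finset.sum_add_distrib]
    refine (congrArg₂ (· + ·) h3 rfl).trans ?_
    rw [← Finset.sum_add_distrib, Finset.smul_sum]
    refine Finset.sum_congr rfl fun i _ => ?_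
    change (((j : ℝ) + 1) • taylorTerm (j + 1) (partialDeriv i f) x ν) * algebraMap ℝ A (t i) +
      ((j : ℝ) • taylorTerm j (partialDeriv i f) x ν) * η i +
      taylorTerm j (partialDeriv i f) x ν * η i =
      ((j : ℝ) + 1) • (taylorTerm (j + 1) (partialDeriv i f) x ν * algebraMap ℝ A (t i) +
        taylorTerm j (partialDeriv i f) x ν * η i)
    simp only [Algebra.smul_def, map_add, map_one]
    ring

end TaylorCalculus

/-! ### Prolongation of smooth functions to `Aⁿ` -/

namespace WeilAlgebra

variable {n : ℕ}

section Algebraic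

variable {A : Type*} [CommRing A] [Algebra ℝ A] [WeilAlgebra A]

/-- The point of `ℝⁿ` formed by the real parts of an element of `Aⁿ`. -/
noncomputable def realPoint (n : ℕ) (A : Type*) [CommRing A] [Algebra ℝ A] [WeilAlgebra A] :
    (Fin n → A) →ₗ[ℝ] EuclideanSpace ℝ (Fin n) :=
  (WithLp.linearEquiv 2 ℝ (Fin n → ℝ)).symm.toLinearMap ∘ₗ
    LinearMap.pi fun i => (realPart A).toLinearMap ∘ₗ LinearMap.proj i

@[simp]
theorem realPoint_apply (a : Fin n → A) (i : Fin n) : realPoint n A a i = realPart A (a i) := rfl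

/-- The nilpotent part of an element of `Aⁿ`. -/
noncomputable def nilPart (n : ℕ) (A : Type*) [CommRing A] [Algebra ℝ A] [WeilAlgebra A] :
    (Fin n → A) →ₗ[ℝ] (Fin n → A) :=
  LinearMap.pi fun i => LinearMap.proj i -
    (Algebra.linearMap ℝ A ∘ₗ (realPart A).toLinearMap) ∘ₗ
      LinearMap.proj (φ := fun _ : Fin n => A) i

theorem nilPart_apply (a : Fin n → A) (i : Fin n) :
    nilPart n A a i = a i - algebraMap ℝ A (realPart A (a i)) := rfl

theorem nilPart_mem (a : Fin n → A) (i : Fin n) :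
    nilPart n A a i ∈ IsLocalRing.maximalIdeal A := sub_realPart_mem (a i)

/-- An exponent that annihilates the maximal ideal. -/
noncomputable def order (A : Type*) [CommRing A] [Algebra ℝ A] [WeilAlgebra A] : ℕ :=
  (nilpotent (A := A)).choose

theorem one_le_order : 1 ≤ order A := (nilpotent (A := A)).choose_spec.1

theorem maximalIdeal_pow_order : IsLocalRing.maximalIdeal A ^ order A = ⊥ :=
  (nilpotent (A := A)).choose_spec.2

theorem eq_zero_of_mem_pow {j : ℕ} (hj : order A ≤ j) {a : A}
    (ha : a ∈ IsLocalRing.maximalIdeal A ^ j) : a = 0 := by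
  have := Ideal.pow_le_pow_right hj ha
  rwa [maximalIdeal_pow_order] at this

/-- The prolongation `f^A : Aⁿ → A` of a real function `f` of `n` variables: the value at `x + ν`,
with `x` real and `ν` nilpotent, is the Taylor expansion of `f` at `x` evaluated at `ν`.
The sum has one more term than needed, so that its derivative in `ν` is again a full expansion. -/
noncomputable def prolong (f : EuclideanSpace ℝ (Fin n) → ℝ) (a : Fin n → A) : A :=
  ∑ j ∈ Finset.range (order A + 1), taylorTerm j f (realPoint n A a) (nilPart n A a)

variable {f g : EuclideanSpace ℝ (Fin n) → ℝ} {a : Fin n → A}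

theorem taylorTerm_order (f : EuclideanSpace ℝ (Fin n) → ℝ) (a : Fin n → A) {j : ℕ}
    (hj : order A ≤ j) : taylorTerm j f (realPoint n A a) (nilPart n A a) = 0 :=
  eq_zero_of_mem_pow hj (taylorTerm_mem_pow _ (nilPart_mem a) j f _)

theorem prolong_congr (h : f =ᶠ[𝓝 (realPoint n A a)] g) : prolong f a = prolong g a :=
  Finset.sum_congr rfl fun j _ => taylorTerm_congr _ j h

theorem prolong_add (hf : ContDiffAt ℝ ∞ f (realPoint n A a))
    (hg : ContDiffAt ℝ ∞ g (realPoint n A a)) :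
    prolong (f + g) a = prolong f a + prolong g a := by
  simp only [prolong, taylorTerm_add _ _ hf hg, Finset.sum_add_distrib]

theorem prolong_mul (hf : ContDiffAt ℝ ∞ f (realPoint n A a))
    (hg : ContDiffAt ℝ ∞ g (realPoint n A a)) :
    prolong (f * g) a = prolong f a * prolong g a := by
  set x := realPoint n A a
  set ν := nilPart n A a
  let F (p : ℕ × ℕ) : A := taylorTerm p.1 f x ν * taylorTerm p.2 g x ν
  have hF : ∀ p : ℕ × ℕ, order A ≤ p.1 + p.2 → F p = 0 := fun p hp => by
    refine eq_zero_of_mem_pow hp ?_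
    rw [pow_add]
    exact Ideal.mul_mem_mul (taylorTerm_mem_pow _ (nilPart_mem a) _ _ _)
      (taylorTerm_mem_pow _ (nilPart_mem a) _ _ _)
  have h1 : prolong f a * prolong g a =
      ∑ p ∈ Finset.range (order A + 1) ×ˢ Finset.range (order A + 1), F p := by
    rw [prolong, prolong, Finset.sum_mul_sum, Finset.sum_product]
  have h2 : prolong (f * g) a = ∑ p ∈ (Finset.range (order A + 1)).biUnion
      Finset.HasAntidiagonal.antidiagonal, F p := by
    rw [Finset.sum_biUnion]
    · exact Finset.sum_congr rfl fun j _ => taylorTerm_mul ν j hf hg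
    · refine fun i _ j _ hij => Finset.disjoint_left.2 fun p hi hj => hij ?_
      rw [← Finset.HasAntidiagonal.mem_antidiagonal.1 hi,
        Finset.HasAntidiagonal.mem_antidiagonal.1 hj]
  rw [h1, h2]
  refine Finset.sum_subset (fun p hp => ?_) (fun p _ hp => hF p ?_)
  · simp only [Finset.mem_biUnion, Finset.mem_range, Finset.HasAntidiagonal.mem_antidiagonal,
      Finset.mem_product] at hp ⊢
    omega
  · simp only [Finset.mem_biUnion, Finset.mem_range, Finset.HasAntidiagonal.mem_antidiagonal,
      exists_eq_right'] at hp
    omega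

theorem prolong_const (c : ℝ) (a : Fin n → A) : prolong (fun _ => c) a = algebraMap ℝ A c := by
  rw [prolong, Finset.sum_range_succ']
  simp only [taylorTerm_const_succ, Finset.sum_const_zero, zero_add]
  rfl

theorem prolong_coord (i : Fin n) (a : Fin n → A) :
    prolong (fun y : EuclideanSpace ℝ (Fin n) => y i) a = a i := by
  obtain ⟨k, hk⟩ : ∃ k, order A = k + 1 := Nat.exists_eq_add_of_le' one_le_order
  rw [prolong, hk, Finset.sum_range_succ', Finset.sum_range_succ']
  simp only [zero_add, taylorTerm_coord_add_two, taylorTerm_coord_one, Finset.sum_const_zero,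
    nilPart_apply]
  rw [taylorTerm, realPoint_apply, sub_add_cancel]

theorem realPart_prolong (f : EuclideanSpace ℝ (Fin n) → ℝ) (a : Fin n → A) :
    realPart A (prolong f a) = f (realPoint n A a) := by
  rw [prolong, Finset.sum_range_succ', map_add, map_sum, Finset.sum_eq_zero, zero_add, taylorTerm,
    realPart_algebraMap]
  intro j _
  rw [← mem_maximalIdeal_iff]
  exact Ideal.pow_le_self (Nat.succ_ne_zero j) (taylorTerm_mem_pow _ (nilPart_mem a) (j + 1) f _)

end Algebraic

section Calculus

variable {A : Type*} [NormedCommRing A] [NormedAlgebra ℝ A] [WeilAlgebra A]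
  {f : EuclideanSpace ℝ (Fin n) → ℝ}

instance finiteDimensional : FiniteDimensional ℝ A := WeilAlgebra.finite

theorem continuous_realPoint : Continuous (realPoint n A) :=
  (realPoint n A).continuous_of_finiteDimensional

theorem contDiffOn_prolong {U : Set (EuclideanSpace ℝ (Fin n))} (hU : IsOpen U)
    (hf : ContDiffOn ℝ ∞ f U) :
    ContDiffOn ℝ ∞ (prolong (A := A) f) (realPoint n A ⁻¹' U) := by
  refine ContDiffOn.sum fun j _ => ?_
  have h := (realPoint n A).toContinuousLinearMap.contDiff (n := ∞) |>.prodMk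
    (nilPart n A).toContinuousLinearMap.contDiff
  exact (hf.taylorTerm (A := A) hU j).comp h.contDiffOn fun a ha => ⟨ha, trivial⟩

/-- The derivative of `f^A` is `A`-linear, with coefficients the prolongations of the partial
derivatives of `f`. -/
theorem hasFDerivAt_prolong {a : Fin n → A} (hf : ContDiffAt ℝ ∞ f (realPoint n A a)) :
    HasFDerivAt (prolong f) (∑ i, (ContinuousLinearMap.mul ℝ A (prolong (partialDeriv i f) a)).comp
      (ContinuousLinearMap.proj (R := ℝ) (φ := fun _ : Fin n => A) i)) a := by
  have h0 : HasFDerivAt (fun a : Fin n → A => (realPoint n A a, nilPart n A a))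
      ((realPoint n A).toContinuousLinearMap.prod (nilPart n A).toContinuousLinearMap) a :=
    ((realPoint n A).toContinuousLinearMap.prod (nilPart n A).toContinuousLinearMap).hasFDerivAt
  have h1 := HasFDerivAt.fun_sum (u := Finset.range (order A + 1))
    fun j _ => (hasFDerivAt_taylorTerm j hf (nilPart n A a)).comp a h0
  refine h1.congr_fderiv (ContinuousLinearMap.ext fun h => ?_)
  have hp : ∀ i, (∑ j ∈ Finset.range (order A + 1),
      taylorTermPred j (partialDeriv i f) (realPoint n A a) (nilPart n A a)) =
      prolong (partialDeriv i f) a := fun i => by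
    rw [Finset.sum_range_succ', prolong, Finset.sum_range_succ, taylorTerm_order _ _ le_rfl]
    rfl
  simp only [sum_apply, ContinuousLinearMap.comp_apply, ContinuousLinearMap.mul_apply',
    ContinuousLinearMap.proj_apply, add_apply]
  rw [Finset.sum_comm]
  refine Finset.sum_congr rfl fun i _ => ?_
  rw [Finset.sum_add_distrib]
  change ∑ j ∈ Finset.range (order A + 1), taylorTerm j (partialDeriv i f) (realPoint n A a)
        (nilPart n A a) * algebraMap ℝ A (realPart A (h i)) +
      ∑ j ∈ Finset.range (order A + 1), taylorTermPred j (partialDeriv i f) (realPoint n A a)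
        (nilPart n A a) * nilPart n A h i = _
  rw [← Finset.sum_mul, ← Finset.sum_mul, hp, nilPart_apply, ← prolong]
  ring

/-- The prolongation `F^A : Aⁿ → Aⁿ` of a map `F : ℝⁿ → ℝⁿ`. -/
noncomputable def prolongMap (F : EuclideanSpace ℝ (Fin n) → EuclideanSpace ℝ (Fin n))
    (a : Fin n → A) : Fin n → A :=
  fun i => prolong (fun y => F y i) a

/-- The prolongation of the Jacobian matrix. -/
noncomputable def prolongJacobian (F : EuclideanSpace ℝ (Fin n) → EuclideanSpace ℝ (Fin n))
    (a : Fin n → A) : Matrix (Fin n) (Fin n) A :=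
  Matrix.of fun i j => prolong (partialDeriv j fun y => F y i) a

variable {F : EuclideanSpace ℝ (Fin n) → EuclideanSpace ℝ (Fin n)}

theorem contDiffOn_prolongMap {U : Set (EuclideanSpace ℝ (Fin n))} (hU : IsOpen U)
    (hF : ContDiffOn ℝ ∞ F U) :
    ContDiffOn ℝ ∞ (prolongMap (A := A) F) (realPoint n A ⁻¹' U) :=
  contDiffOn_pi.2 fun i => contDiffOn_prolong hU (contDiffOn_euclidean.1 hF i)

theorem hasFDerivAt_prolongMap {a : Fin n → A} (hF : ContDiffAt ℝ ∞ F (realPoint n A a)) :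
    HasFDerivAt (prolongMap F) (LinearMap.toContinuousLinearMap
      ((Matrix.toLin' (prolongJacobian F a)).restrictScalars ℝ)) a := by
  refine hasFDerivAt_pi'.2 fun i => ?_
  refine (hasFDerivAt_prolong (contDiffAt_euclidean.1 hF i)).congr_fderiv ?_
  ext h
  simp [prolongJacobian, Matrix.mulVec, dotProduct]

theorem realPart_det_prolongJacobian {a : Fin n → A}
    (hF : DifferentiableAt ℝ F (realPoint n A a)) :
    realPart A (prolongJacobian F a).det = (fderiv ℝ F (realPoint n A a)).det := by
  rw [AlgHom.map_det, ContinuousLinearMap.det,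
    ← LinearMap.det_toMatrix (EuclideanSpace.basisFun (Fin n) ℝ).toBasis]
  congr 1
  ext i j
  have h : fderiv ℝ (fun y => F y i) (realPoint n A a) =
      (EuclideanSpace.proj i : EuclideanSpace ℝ (Fin n) →L[ℝ] ℝ).comp
        (fderiv ℝ F (realPoint n A a)) :=
    ((EuclideanSpace.proj i : EuclideanSpace ℝ (Fin n) →L[ℝ] ℝ).hasFDerivAt.comp _
      hF.hasFDerivAt).fderiv
  simp [prolongJacobian, realPart_prolong, partialDeriv, LinearMap.toMatrix_apply, h]

/-- The derivative of `F^A` is the multiplication by a matrix over `A` with the Jacobian matrix of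
`F` as its real part; its real determinant is the norm of the determinant over `A`. -/
theorem det_fderiv_prolongMap_pos {a : Fin n → A} (hF : ContDiffAt ℝ ∞ F (realPoint n A a))
    (hpos : 0 < (fderiv ℝ F (realPoint n A a)).det) :
    0 < (fderiv ℝ (prolongMap (A := A) F) a).det := by
  rw [(hasFDerivAt_prolongMap hF).fderiv, ContinuousLinearMap.det,
    LinearMap.coe_toContinuousLinearMap, LinearMap.det_restrictScalars, LinearMap.det_toLin']
  refine norm_pos ?_
  rwa [realPart_det_prolongJacobian (hF.differentiableAt (by simp))]

end Calculus

end WeilAlgebra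

/-! ### Points of the Weil bundle and their coordinates -/

namespace WeilBundle

open WeilAlgebra

variable {n : ℕ} {M : Type*} [TopologicalSpace M] [ChartedSpace (EuclideanSpace ℝ (Fin n)) M]

theorem ext_of_hom_of_base {A : Type*} [CommRing A] [Algebra ℝ A] [WeilAlgebra A]
    {ζ ζ' : WeilBundle n M A} (h : ∀ f, ζ.hom f = ζ'.hom f)
    (h' : ζ.base = ζ'.base) : ζ = ζ' := by
  obtain ⟨F, x, h1⟩ := ζ
  obtain ⟨F', x', h1'⟩ := ζ'
  obtain rfl : F = F' := AlgHom.ext h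
  obtain rfl : x = x' := h'
  rfl

section Topology

variable {A : Type*} [NormedCommRing A] [NormedAlgebra ℝ A] [WeilAlgebra A]

theorem continuous_hom (f : C^∞⟮𝓡 n, M; ℝ⟯) : Continuous fun ζ : WeilBundle n M A => ζ.hom f := by
  let b := Module.finBasis ℝ A
  have h : ∀ l : A →ₗ[ℝ] ℝ, Continuous fun ζ : WeilBundle n M A => l (ζ.hom f) := fun l =>
    continuous_iff_le_induced.2 ((iInf_le _ f).trans (iInf_le _ l))
  have h2 : Continuous fun ζ : WeilBundle n M A => b.equivFun.toContinuousLinearEquiv (ζ.hom f) :=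
    continuous_pi fun i => h (b.coord i)
  refine (b.equivFun.toContinuousLinearEquiv.symm.continuous.comp h2).congr fun ζ => ?_
  exact b.equivFun.symm_apply_apply (ζ.hom f)

theorem continuous_of_hom {X : Type*} [TopologicalSpace X] {g : X → WeilBundle n M A}
    (h : ∀ f, Continuous fun x => (g x).hom f) : Continuous g := by
  refine continuous_iInf_rng.2 fun f => continuous_iInf_rng.2 fun l => continuous_induced_rng.2 ?_
  exact l.continuous_of_finiteDimensional.comp (h f)

theorem continuous_map {N : Type*} [TopologicalSpace N] [ChartedSpace (EuclideanSpace ℝ (Fin n)) N]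
    (f : C^∞⟮𝓡 n, M; 𝓡 n, N⟯) : Continuous (map (A := A) f) :=
  continuous_of_hom fun g => continuous_hom (g.comp f)

variable [T2Space M] [IsManifold (𝓡 n) ∞ M]

theorem continuous_base : Continuous (base : WeilBundle n M A → M) := by
  refine continuous_iff_continuousAt.2 fun ζ => ?_
  refine ((SmoothBumpFunction.nhds_basis_support (I := 𝓡 n) (c := ζ.base)
    (s := Set.univ) Filter.univ_mem).tendsto_right_iff).2 fun χ _ => ?_
  -- `χ(base ξ)` is the real part of `ξ(χ)`, and the support of `χ` is a small neighbourhood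
  have hc : Continuous fun ξ : WeilBundle n M A => χ ξ.base := by
    have := ((realPart A).toLinearMap.continuous_of_finiteDimensional).comp
      (continuous_hom (A := A) (⟨χ, χ.contMDiff⟩ : C^∞⟮𝓡 n, M; ℝ⟯))
    refine this.congr fun ξ => ?_
    exact ξ.realPart_hom _
  refine (hc.continuousAt (x := ζ)).eventually_ne ?_
  rw [χ.eq_one]
  exact one_ne_zero

theorem t2Space : T2Space (WeilBundle n M A) := by
  refine T2Space.of_injective_continuous
    (f := fun ζ : WeilBundle n M A => ((fun f => ζ.hom f : C^∞⟮𝓡 n, M; ℝ⟯ → A), ζ.base)) ?_ ?_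
  · intro ζ ζ' h
    rw [Prod.mk.injEq] at h
    exact ext_of_hom_of_base (fun f => congrFun h.1 f) h.2
  · exact (continuous_pi fun f => continuous_hom f).prodMk continuous_base

end Topology

section Coordinates

variable {A : Type*} [CommRing A] [Algebra ℝ A] [WeilAlgebra A]
  {φ : OpenPartialHomeomorph M (EuclideanSpace ℝ (Fin n))}

/-- The coordinates of an `A`-point in a chart `φ = (x¹, …, xⁿ)` of the base, as the element
`(ζ(x¹), …, ζ(xⁿ))` of `Aⁿ`. -/
noncomputable def coordPoint (φ : OpenPartialHomeomorph M (EuclideanSpace ℝ (Fin n)))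
    (ζ : WeilBundle n M A) : Fin n → A :=
  fun i => ζ.eval fun y => φ y i

theorem contDiffOn_comp_symm (hφ : φ ∈ IsManifold.maximalAtlas (𝓡 n) ∞ M)
    (f : C^∞⟮𝓡 n, M; ℝ⟯) : ContDiffOn ℝ ∞ (f ∘ φ.symm) φ.target :=
  contMDiffOn_iff_contDiffOn.1
    (f.contMDiff.comp_contMDiffOn (contMDiffOn_symm_of_mem_maximalAtlas hφ))

theorem contDiffAt_comp_symm (hφ : φ ∈ IsManifold.maximalAtlas (𝓡 n) ∞ M)
    (f : C^∞⟮𝓡 n, M; ℝ⟯) {y : EuclideanSpace ℝ (Fin n)} (hy : y ∈ φ.target) :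
    ContDiffAt ℝ ∞ (f ∘ φ.symm) y :=
  (contDiffOn_comp_symm hφ f).contDiffAt (φ.open_target.mem_nhds hy)

/-- The `A`-point over `x` that evaluates functions at `x`. -/
noncomputable def ofBase (x : M) : WeilBundle n M A where
  hom :=
    { toFun := fun f => algebraMap ℝ A (f x)
      map_one' := by simp
      map_mul' := fun f g => by simp
      map_zero' := by simp
      map_add' := fun f g => by simp
      commutes' := fun r => rfl }
  base := x
  realPart_hom := fun f => realPart_algebraMap (f x)

open Classical in
/-- The `A`-point with given coordinates in `Aⁿ`: it maps `f` to the prolongation of the local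
expression of `f`. Outside of the range of the coordinates the value is irrelevant. -/
noncomputable def ofCoordPoint (φ : OpenPartialHomeomorph M (EuclideanSpace ℝ (Fin n)))
    (hφ : φ ∈ IsManifold.maximalAtlas (𝓡 n) ∞ M) (a : Fin n → A) : WeilBundle n M A :=
  if h : realPoint n A a ∈ φ.target then
    { hom :=
        { toFun := fun f => prolong (f ∘ φ.symm) a
          map_one' := (prolong_const 1 a).trans (map_one _)
          map_mul' := fun f g =>
            prolong_mul (contDiffAt_comp_symm hφ f h) (contDiffAt_comp_symm hφ g h)
          map_zero' := (prolong_const 0 a).trans (map_zero _)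
          map_add' := fun f g =>
            prolong_add (contDiffAt_comp_symm hφ f h) (contDiffAt_comp_symm hφ g h)
          commutes' := fun r => prolong_const r a }
      base := φ.symm (realPoint n A a)
      realPart_hom := fun f => realPart_prolong (f ∘ φ.symm) a }
  else ofBase (φ.symm (realPoint n A a))

variable (hφ : φ ∈ IsManifold.maximalAtlas (𝓡 n) ∞ M)

theorem base_ofCoordPoint (a : Fin n → A) :
    (ofCoordPoint φ hφ a).base = φ.symm (realPoint n A a) := by
  unfold ofCoordPoint
  split_ifs <;> rfl

theorem hom_ofCoordPoint {a : Fin n → A} (ha : realPoint n A a ∈ φ.target)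
    (f : C^∞⟮𝓡 n, M; ℝ⟯) : (ofCoordPoint φ hφ a).hom f = prolong (f ∘ φ.symm) a := by
  rw [ofCoordPoint, dif_pos ha]
  rfl

variable [T2Space M] [IsManifold (𝓡 n) ∞ M]

include hφ in
theorem exists_coord_eventuallyEq {x : M} (hx : x ∈ φ.source) (i : Fin n) :
    ∃ p : C^∞⟮𝓡 n, M; ℝ⟯, (p : M → ℝ) =ᶠ[𝓝 x] fun y => φ y i := by
  refine exists_eventuallyEq φ.open_source hx ?_
  exact ((EuclideanSpace.proj i : EuclideanSpace ℝ (Fin n) →L[ℝ] ℝ).contMDiff (n := ∞)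
    ).comp_contMDiffOn (contMDiffOn_of_mem_maximalAtlas hφ)

include hφ in
theorem realPoint_coordPoint {ζ : WeilBundle n M A} (hζ : ζ.base ∈ φ.source) :
    realPoint n A (coordPoint φ ζ) = φ ζ.base := by
  ext i
  obtain ⟨p, hp⟩ := exists_coord_eventuallyEq hφ hζ i
  rw [realPoint_apply, coordPoint, ζ.eval_eq p hp, ζ.realPart_hom, hp.eq_of_nhds]

theorem coordPoint_ofCoordPoint {a : Fin n → A} (ha : realPoint n A a ∈ φ.target) :
    coordPoint φ (ofCoordPoint φ hφ a) = a := by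
  have hs : (ofCoordPoint φ hφ a).base ∈ φ.source := by
    rw [base_ofCoordPoint]
    exact φ.map_target ha
  funext i
  obtain ⟨p, hp⟩ := exists_coord_eventuallyEq hφ hs i
  rw [coordPoint, eval_eq _ p hp, hom_ofCoordPoint hφ ha]
  rw [base_ofCoordPoint] at hp
  refine Eq.trans (prolong_congr ?_) (prolong_coord i a)
  filter_upwards [(φ.continuousAt_symm ha).eventually hp, φ.open_target.mem_nhds ha] with y h1 h2
  simp only [Function.comp_apply, h1, φ.right_inv h2]

include hφ in
/-- Hadamard's lemma on a manifold: near `x`, a smooth function is a constant plus a combination of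
the coordinates centred at `x` with globally smooth coefficients. -/
theorem exists_hadamard_chart {x : M} (hx : x ∈ φ.source) (f : C^∞⟮𝓡 n, M; ℝ⟯) :
    ∃ p g : Fin n → C^∞⟮𝓡 n, M; ℝ⟯, (∀ i, (p i : M → ℝ) =ᶠ[𝓝 x] fun y => φ y i) ∧
      (f : M → ℝ) =ᶠ[𝓝 x] (algebraMap ℝ C^∞⟮𝓡 n, M; ℝ⟯ (f x) +
        ∑ i, (p i - algebraMap ℝ C^∞⟮𝓡 n, M; ℝ⟯ (φ x i)) * g i : C^∞⟮𝓡 n, M; ℝ⟯) := by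
  obtain ⟨F, hF⟩ := exists_eventuallyEq φ.open_target (φ.map_source hx)
    (contMDiffOn_iff_contDiffOn.2 (contDiffOn_comp_symm hφ f))
  obtain ⟨G, hG, hFG⟩ := exists_hadamard (contMDiff_iff_contDiff.1 F.contMDiff) (φ x)
  choose p hp using exists_coord_eventuallyEq hφ hx
  have hg : ∀ i, ∃ g : C^∞⟮𝓡 n, M; ℝ⟯, (g : M → ℝ) =ᶠ[𝓝 x] fun y => G i (φ y) := fun i => by
    refine exists_eventuallyEq φ.open_source hx ?_
    exact (contMDiff_iff_contDiff.2 (hG i)).comp_contMDiffOn (contMDiffOn_of_mem_maximalAtlas hφ)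
  choose g hg using hg
  refine ⟨p, g, hp, ?_⟩
  filter_upwards [(φ.continuousAt hx).eventually hF, φ.open_source.mem_nhds hx,
    Filter.eventually_all.2 hp, Filter.eventually_all.2 hg] with y h1 h2 h3 h4
  have h5 : f y = F (φ y) := by rw [h1, Function.comp_apply, φ.left_inv h2]
  have h6 : f x = F (φ x) := by rw [hF.eq_of_nhds, Function.comp_apply, φ.left_inv hx]
  have hsum : ∀ q : Fin n → C^∞⟮𝓡 n, M; ℝ⟯, (∑ i, q i : C^∞⟮𝓡 n, M; ℝ⟯) y = ∑ i, q i y := fun q =>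
    map_sum (ContMDiffMap.evalRingHom (I := 𝓡 n) (R := ℝ) (n := ∞) y) q Finset.univ
  rw [ContMDiffMap.coe_add, Pi.add_apply, hsum, h5, hFG]
  refine congrArg₂ (· + ·) h6.symm (Finset.sum_congr rfl fun i _ => ?_)
  rw [ContMDiffMap.coe_mul, Pi.mul_apply, ContMDiffMap.coe_sub, Pi.sub_apply, h3 i, h4 i]
  rfl

include hφ in
/-- An `A`-point is determined by its coordinates: by Hadamard's lemma, the values of two
`A`-points with the same coordinates agree modulo every power of the maximal ideal. -/
theorem ext_of_coordPoint {ζ ζ' : WeilBundle n M A} (hb : ζ.base = ζ'.base)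
    (hζ : ζ.base ∈ φ.source) (h : coordPoint φ ζ = coordPoint φ ζ') : ζ = ζ' := by
  have key : ∀ (j : ℕ) (f : C^∞⟮𝓡 n, M; ℝ⟯),
      ζ.hom f - ζ'.hom f ∈ IsLocalRing.maximalIdeal A ^ j := by
    intro j
    induction j with
    | zero => simp
    | succ j ih =>
      intro f
      obtain ⟨p, g, hp, hf⟩ := exists_hadamard_chart hφ hζ f
      have h1 : ∀ i, ζ.hom (p i) = coordPoint φ ζ i := fun i => (ζ.eval_eq (p i) (hp i)).symm
      have h2 : ∀ i, ζ'.hom (p i) = coordPoint φ ζ i := fun i => by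
        rw [h]
        exact (ζ'.eval_eq (p i) (hb ▸ hp i)).symm
      rw [ζ.hom_congr hf, ζ'.hom_congr (hf.filter_mono (by rw [hb] : 𝓝 ζ'.base ≤ 𝓝 ζ.base))]
      simp only [map_add, map_sum, map_mul, map_sub, AlgHom.commutes, h1, h2]
      rw [add_sub_add_left_eq_sub, ← Finset.sum_sub_distrib]
      refine Ideal.sum_mem _ fun i _ => ?_
      rw [← mul_sub, pow_succ']
      refine Ideal.mul_mem_mul ?_ (ih (g i))
      rw [mem_maximalIdeal_iff, map_sub, realPart_algebraMap, ← h1, ζ.realPart_hom,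
        (hp i).eq_of_nhds, sub_self]
  exact ext_of_hom_of_base (fun f => sub_eq_zero.1 (eq_zero_of_mem_pow le_rfl (key _ f))) hb

theorem ofCoordPoint_coordPoint {ζ : WeilBundle n M A} (hζ : ζ.base ∈ φ.source) :
    ofCoordPoint φ hφ (coordPoint φ ζ) = ζ := by
  have hr := realPoint_coordPoint hφ hζ
  have hb : (ofCoordPoint φ hφ (coordPoint φ ζ)).base = ζ.base := by
    rw [base_ofCoordPoint, hr, φ.left_inv hζ]
  refine ext_of_coordPoint hφ hb (hb ▸ hζ) (coordPoint_ofCoordPoint hφ ?_)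
  rw [hr]
  exact φ.map_source hζ

include hφ in
/-- The value of an `A`-point at `f` is the prolongation of the local expression of `f`. -/
theorem hom_eq_prolong {ζ : WeilBundle n M A} (hζ : ζ.base ∈ φ.source) (f : C^∞⟮𝓡 n, M; ℝ⟯) :
    ζ.hom f = prolong (f ∘ φ.symm) (coordPoint φ ζ) := by
  conv_lhs => rw [← ofCoordPoint_coordPoint hφ hζ]
  refine hom_ofCoordPoint hφ ?_ f
  rw [realPoint_coordPoint hφ hζ]
  exact φ.map_source hζ

include hφ in
/-- In coordinates with values in `Aⁿ`, the map `f^A` is the prolongation of the local expression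
of `f`. -/
theorem coordPoint_map {N : Type*} [TopologicalSpace N]
    [ChartedSpace (EuclideanSpace ℝ (Fin n)) N] [T2Space N] [IsManifold (𝓡 n) ∞ N]
    {ψ : OpenPartialHomeomorph N (EuclideanSpace ℝ (Fin n))}
    (hψ : ψ ∈ IsManifold.maximalAtlas (𝓡 n) ∞ N) (f : C^∞⟮𝓡 n, M; 𝓡 n, N⟯)
    {ζ : WeilBundle n M A} (hζ : ζ.base ∈ φ.source) (hf : f ζ.base ∈ ψ.source) :
    coordPoint ψ (map f ζ) = fun i =>
      prolong (fun y => (ψ ∘ f ∘ φ.symm) y i) (coordPoint φ ζ) := by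
  funext i
  obtain ⟨p, hp⟩ := exists_coord_eventuallyEq hψ hf i
  rw [coordPoint, eval_eq (map f ζ) p hp]
  change ζ.hom (p.comp f) = _
  rw [hom_eq_prolong hφ hζ]
  refine prolong_congr ?_
  rw [realPoint_coordPoint hφ hζ]
  have h1 : Filter.Tendsto (f ∘ φ.symm) (𝓝 (φ ζ.base)) (𝓝 (f ζ.base)) := by
    have := (f.contMDiff.continuous.continuousAt (x := ζ.base)).tendsto.comp
      (φ.tendsto_symm hζ)
    exact this
  filter_upwards [h1.eventually hp] with y hy
  exact hy

end Coordinates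

end WeilBundle

/-! ### Orientations generated by a covering family of charts -/

section Orientation

variable {ι X : Type*} [Fintype ι] [TopologicalSpace X]

/-- The Jacobian determinant at `x` of the change of charts from `e` to `e'`. -/
noncomputable def chartJacobian (e e' : OpenPartialHomeomorph X (EuclideanSpace ℝ ι)) (x : X) : ℝ :=
  (fderiv ℝ (e' ∘ e.symm) (e x)).det

variable {e e' s : OpenPartialHomeomorph X (EuclideanSpace ℝ ι)}

theorem chartJacobian_self {x : X} (hx : x ∈ e.source) : chartJacobian e e x = 1 := by
  have h : e ∘ e.symm =ᶠ[𝓝 (e x)] id := by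
    filter_upwards [e.open_target.mem_nhds (e.map_source hx)] with y hy
    exact e.right_inv hy
  rw [chartJacobian, h.fderiv_eq, fderiv_id]
  exact LinearMap.det_id

variable [ChartedSpace (EuclideanSpace ℝ ι) X]

theorem contDiffOn_chart_change (he : e ∈ IsManifold.maximalAtlas 𝓘(ℝ, EuclideanSpace ℝ ι) ∞ X)
    (he' : e' ∈ IsManifold.maximalAtlas 𝓘(ℝ, EuclideanSpace ℝ ι) ∞ X) :
    ContDiffOn ℝ ∞ (e' ∘ e.symm) (e.target ∩ e.symm ⁻¹' e'.source) :=
  contMDiffOn_iff_contDiffOn.1 <| (contMDiffOn_of_mem_maximalAtlas he').comp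
    ((contMDiffOn_symm_of_mem_maximalAtlas he).mono Set.inter_subset_left) Set.inter_subset_right

theorem differentiableAt_chart_change
    (he : e ∈ IsManifold.maximalAtlas 𝓘(ℝ, EuclideanSpace ℝ ι) ∞ X)
    (he' : e' ∈ IsManifold.maximalAtlas 𝓘(ℝ, EuclideanSpace ℝ ι) ∞ X) {x : X}
    (hx : x ∈ e.source) (hx' : x ∈ e'.source) : DifferentiableAt ℝ (e' ∘ e.symm) (e x) := by
  refine ((contDiffOn_chart_change he he').contDiffAt ?_).differentiableAt (by simp)
  refine (e.isOpen_inter_preimage_symm e'.open_source).mem_nhds ⟨e.map_source hx, ?_⟩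
  rwa [Set.mem_preimage, e.left_inv hx]

theorem isPositiveInCharts_id_iff
    (he : e ∈ IsManifold.maximalAtlas 𝓘(ℝ, EuclideanSpace ℝ ι) ∞ X)
    (he' : e' ∈ IsManifold.maximalAtlas 𝓘(ℝ, EuclideanSpace ℝ ι) ∞ X) :
    IsPositiveInCharts e id e' ↔
      ∀ x ∈ e.source, x ∈ e'.source → 0 < chartJacobian e e' x := by
  refine ⟨fun h x hx hx' => h.2 (e x) ⟨e.map_source hx, ?_⟩,
    fun h => ⟨contDiffOn_chart_change he he', fun v hv => ?_⟩⟩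
  · change e.symm (e x) ∈ e'.source
    rwa [e.left_inv hx]
  · have := h (e.symm v) (e.map_target hv.1) hv.2
    rwa [chartJacobian, e.right_inv hv.1] at this

theorem chartJacobian_trans
    (he : e ∈ IsManifold.maximalAtlas 𝓘(ℝ, EuclideanSpace ℝ ι) ∞ X)
    (hs : s ∈ IsManifold.maximalAtlas 𝓘(ℝ, EuclideanSpace ℝ ι) ∞ X)
    (he' : e' ∈ IsManifold.maximalAtlas 𝓘(ℝ, EuclideanSpace ℝ ι) ∞ X) {x : X}
    (hx : x ∈ e.source) (hxs : x ∈ s.source) (hx' : x ∈ e'.source) :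
    chartJacobian e e' x = chartJacobian s e' x * chartJacobian e s x := by
  have h1 := (differentiableAt_chart_change he hs hx hxs).hasFDerivAt
  have h2 := (differentiableAt_chart_change hs he' hxs hx').hasFDerivAt
  have h3 : (s ∘ e.symm) (e x) = s x := by rw [Function.comp_apply, e.left_inv hx]
  rw [← h3] at h2
  have h4 := h2.comp (e x) h1
  have h5 : (e' ∘ s.symm) ∘ (s ∘ e.symm) =ᶠ[𝓝 (e x)] e' ∘ e.symm := by
    filter_upwards [(e.tendsto_symm hx).eventually (s.open_source.mem_nhds hxs)] with y hy
    simp only [Function.comp_apply, s.left_inv hy]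
  rw [chartJacobian, ← h5.fderiv_eq, h4.fderiv, h3]
  exact LinearMap.det_comp _ _

theorem chartJacobian_pos_symm
    (he : e ∈ IsManifold.maximalAtlas 𝓘(ℝ, EuclideanSpace ℝ ι) ∞ X)
    (hs : s ∈ IsManifold.maximalAtlas 𝓘(ℝ, EuclideanSpace ℝ ι) ∞ X) {x : X}
    (hx : x ∈ e.source) (hxs : x ∈ s.source) (h : 0 < chartJacobian e s x) :
    0 < chartJacobian s e x := by
  refine pos_of_mul_pos_left ?_ h.le
  rw [← chartJacobian_trans he hs he hx hxs hx, chartJacobian_self hx]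
  exact one_pos

/-- Two charts with positive Jacobian determinants towards all members of a covering family have
positive Jacobian determinants between each other. -/
theorem IsPositiveInCharts.of_cover
    {S : Set (OpenPartialHomeomorph X (EuclideanSpace ℝ ι))}
    (hS : S ⊆ IsManifold.maximalAtlas 𝓘(ℝ, EuclideanSpace ℝ ι) ∞ X)
    (hcover : ∀ x : X, ∃ s ∈ S, x ∈ s.source)
    (he : e ∈ IsManifold.maximalAtlas 𝓘(ℝ, EuclideanSpace ℝ ι) ∞ X)
    (he' : e' ∈ IsManifold.maximalAtlas 𝓘(ℝ, EuclideanSpace ℝ ι) ∞ X)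
    (h : ∀ s ∈ S, IsPositiveInCharts e id s) (h' : ∀ s ∈ S, IsPositiveInCharts e' id s) :
    IsPositiveInCharts e id e' := by
  refine (isPositiveInCharts_id_iff he he').2 fun x hx hx' => ?_
  obtain ⟨s, hs, hxs⟩ := hcover x
  rw [chartJacobian_trans he (hS hs) he' hx hxs hx']
  have h1 := (isPositiveInCharts_id_iff he (hS hs)).1 (h s hs) x hx hxs
  have h2 := (isPositiveInCharts_id_iff he' (hS hs)).1 (h' s hs) x hx' hxs
  exact mul_pos (chartJacobian_pos_symm he' (hS hs) hx' hxs h2) h1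

/-- A covering family of charts with positive Jacobian determinants of the changes of charts is
contained in exactly one orientation. -/
theorem SmoothOrientation.existsUnique_of_cover
    {S : Set (OpenPartialHomeomorph X (EuclideanSpace ℝ ι))}
    (hS : S ⊆ IsManifold.maximalAtlas 𝓘(ℝ, EuclideanSpace ℝ ι) ∞ X)
    (hcover : ∀ x : X, ∃ s ∈ S, x ∈ s.source)
    (hpos : ∀ s ∈ S, ∀ s' ∈ S, IsPositiveInCharts s id s') :
    ∃! O : SmoothOrientation ι X, S ⊆ O.charts := by
  let C : Set (OpenPartialHomeomorph X (EuclideanSpace ℝ ι)) :=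
    {e | e ∈ IsManifold.maximalAtlas 𝓘(ℝ, EuclideanSpace ℝ ι) ∞ X ∧
      ∀ s ∈ S, IsPositiveInCharts e id s}
  have hSC : S ⊆ C := fun s hs => ⟨hS hs, hpos s hs⟩
  refine ⟨⟨C, fun e he => he.1, fun x => ?_, fun e he e' he' =>
    .of_cover hS hcover he.1 he'.1 he.2 he'.2,
    fun e he h => ⟨he, fun s hs => h s (hSC hs)⟩⟩, hSC, fun O hO => ?_⟩
  · obtain ⟨s, hs, hx⟩ := hcover x
    exact ⟨s, hSC hs, hx⟩
  · have : O.charts = C := by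
      refine Set.Subset.antisymm (fun e he => ⟨O.subset_maximalAtlas he, fun s hs =>
        O.positive e he s (hO hs)⟩) fun e he => O.maximal e he.1 fun e' he' => ?_
      exact .of_cover hS hcover he.1 (O.subset_maximalAtlas he') he.2
        fun s hs => O.positive e' he' s (hO hs)
    cases O
    subst this
    rfl

end Orientation

/-! ### The charts of the Weil bundle and their changes -/

namespace WeilBundle

open WeilAlgebra

section BasisCoordinates

variable {A : Type*} [NormedCommRing A] [NormedAlgebra ℝ A] [WeilAlgebra A]
  {κ : Type*} [Fintype κ]

/-- The real coordinates on `Aⁿ` with respect to a basis of `A`. -/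
noncomputable def basisCoord (n : ℕ) (b : Module.Basis κ ℝ A) :
    (Fin n → A) ≃ₗ[ℝ] EuclideanSpace ℝ (Fin n × κ) :=
  (LinearEquiv.piCongrRight fun _ => b.equivFun) ≪≫ₗ
    (LinearEquiv.curry ℝ ℝ (Fin n) κ).symm ≪≫ₗ (WithLp.linearEquiv 2 ℝ (Fin n × κ → ℝ)).symm

/-- The change of real coordinates of `Aⁿ` is `n` copies of a linear map `t` of `A` that takes the
basis `b'` to `b`, so its determinant is the inverse of `(b.det b')ⁿ`. -/
theorem det_basisCoord_comp_symm_pos [DecidableEq κ] {n : ℕ} (b b' : Module.Basis κ ℝ A)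
    (h : 0 < b.det b' ^ n) :
    0 < LinearMap.det ((basisCoord n b').toLinearMap ∘ₗ (basisCoord n b).symm.toLinearMap) := by
  let t : A →ₗ[ℝ] A := (b'.equivFun ≪≫ₗ b.equivFun.symm).toLinearMap
  have ht : t.det * b.det b' = 1 := by
    rw [← Module.Basis.det_comp, ← b.det_self]
    congr 1
    ext k
    simp [t, Module.Basis.equivFun_symm_apply, Finsupp.single_apply]
  have h1 : (basisCoord n b').toLinearMap ∘ₗ (basisCoord n b).symm.toLinearMap =
      (basisCoord n b).toLinearMap ∘ₗ
        (LinearMap.pi fun i => t ∘ₗ LinearMap.proj i : (Fin n → A) →ₗ[ℝ] (Fin n → A)) ∘ₗ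
        (basisCoord n b).symm.toLinearMap := by
    refine LinearMap.ext fun v => ?_
    simp only [LinearMap.comp_apply, LinearEquiv.coe_coe]
    refine (basisCoord n b).symm.injective ?_
    rw [LinearEquiv.symm_apply_apply]
    rfl
  rw [h1, LinearMap.det_conj, LinearMap.det_pi, Finset.prod_const, Finset.card_univ,
    Fintype.card_fin]
  refine pos_of_mul_pos_left ?_ h.le
  rw [← mul_pow, ht, one_pow]
  exact one_pos

end BasisCoordinates

variable {n : ℕ} {M : Type*} [TopologicalSpace M] [ChartedSpace (EuclideanSpace ℝ (Fin n)) M]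
  {A : Type*} [NormedCommRing A] [NormedAlgebra ℝ A] [WeilAlgebra A]
  {κ : Type*} [Fintype κ] {b b' : Module.Basis κ ℝ A}
  {φ : OpenPartialHomeomorph M (EuclideanSpace ℝ (Fin n))}

theorem coord_eq (b : Module.Basis κ ℝ A)
    (φ : OpenPartialHomeomorph M (EuclideanSpace ℝ (Fin n))) (ζ : WeilBundle n M A) :
    coord b φ ζ = basisCoord n b (coordPoint φ ζ) := rfl

theorem IsLift.coordPoint_symm
    {e : OpenPartialHomeomorph (WeilBundle n M A) (EuclideanSpace ℝ (Fin n × κ))}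
    (he : IsLift b φ e) {v : EuclideanSpace ℝ (Fin n × κ)}
    (hv : v ∈ e.target) : coordPoint φ (e.symm v) = (basisCoord n b).symm v := by
  rw [LinearEquiv.eq_symm_apply, ← coord_eq, ← he.2 (e.map_target hv), e.right_inv hv]

theorem IsLift.base_symm_mem
    {e : OpenPartialHomeomorph (WeilBundle n M A) (EuclideanSpace ℝ (Fin n × κ))}
    (he : IsLift b φ e) {v : EuclideanSpace ℝ (Fin n × κ)}
    (hv : v ∈ e.target) : (e.symm v).base ∈ φ.source := by
  have := e.map_target hv
  rwa [he.1] at this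

theorem continuousOn_ofCoordPoint (hφ : φ ∈ IsManifold.maximalAtlas (𝓡 n) ∞ M) :
    ContinuousOn (ofCoordPoint (A := A) φ hφ) (realPoint n A ⁻¹' φ.target) := by
  rw [continuousOn_iff_continuous_domRestrict]
  refine continuous_of_hom fun f => ?_
  have := (contDiffOn_prolong (A := A) φ.open_target (contDiffOn_comp_symm hφ f)).continuousOn
  refine (continuousOn_iff_continuous_domRestrict.1 this).congr fun a => ?_
  exact (hom_ofCoordPoint hφ a.2 f).symm

theorem map_id : map (A := A) (ContMDiffMap.id : C^∞⟮𝓡 n, M; 𝓡 n, M⟯) = id := rfl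

variable [T2Space M] [IsManifold (𝓡 n) ∞ M]

theorem continuousOn_coordPoint (hφ : φ ∈ IsManifold.maximalAtlas (𝓡 n) ∞ M) :
    ContinuousOn (coordPoint (A := A) φ) (base ⁻¹' φ.source) := by
  refine continuousOn_pi.2 fun i ζ hζ => ContinuousAt.continuousWithinAt ?_
  obtain ⟨p, hp⟩ := exists_coord_eventuallyEq hφ hζ i
  refine (continuous_hom (A := A) p).continuousAt.congr ?_
  filter_upwards [continuous_base.continuousAt.eventually hp.eventuallyEq_nhds] with ξ hξ
  exact (ξ.eval_eq p hξ).symm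

/-- The chart `φ^A` of the Weil bundle. -/
noncomputable def liftChart (b : Module.Basis κ ℝ A)
    (φ : OpenPartialHomeomorph M (EuclideanSpace ℝ (Fin n)))
    (hφ : φ ∈ IsManifold.maximalAtlas (𝓡 n) ∞ M) :
    OpenPartialHomeomorph (WeilBundle n M A) (EuclideanSpace ℝ (Fin n × κ)) where
  toFun ζ := basisCoord n b (coordPoint φ ζ)
  invFun v := ofCoordPoint φ hφ ((basisCoord n b).symm v)
  source := base ⁻¹' φ.source
  target := (basisCoord n b).symm ⁻¹' (realPoint n A ⁻¹' φ.target)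
  map_source' ζ hζ := by
    rw [Set.mem_preimage, LinearEquiv.symm_apply_apply, Set.mem_preimage,
      realPoint_coordPoint hφ hζ]
    exact φ.map_source hζ
  map_target' v hv := by
    rw [Set.mem_preimage, base_ofCoordPoint]
    exact φ.map_target hv
  left_inv' ζ hζ := by
    rw [LinearEquiv.symm_apply_apply, ofCoordPoint_coordPoint hφ hζ]
  right_inv' v hv := by
    rw [coordPoint_ofCoordPoint hφ hv, LinearEquiv.apply_symm_apply]
  open_source := φ.open_source.preimage continuous_base
  open_target := (φ.open_target.preimage continuous_realPoint).preimage
    (basisCoord n b).symm.toLinearMap.continuous_of_finiteDimensional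
  continuousOn_toFun := (basisCoord n b).toLinearMap.continuous_of_finiteDimensional.comp_continuousOn
    (continuousOn_coordPoint hφ)
  continuousOn_invFun := (continuousOn_ofCoordPoint hφ).comp
    (basisCoord n b).symm.toLinearMap.continuous_of_finiteDimensional.continuousOn fun _ hv => hv

theorem isLift_liftChart (b : Module.Basis κ ℝ A) (hφ : φ ∈ IsManifold.maximalAtlas (𝓡 n) ∞ M) :
    IsLift b φ (liftChart b φ hφ) := ⟨rfl, fun _ _ => rfl⟩

theorem secondCountableTopology [SecondCountableTopology M] (b : Module.Basis κ ℝ A) :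
    SecondCountableTopology (WeilBundle n M A) := by
  obtain ⟨S, hS, hSU⟩ := TopologicalSpace.countable_cover_nhds
    fun x : M => chart_source_mem_nhds (EuclideanSpace ℝ (Fin n)) x
  let E (x : M) := liftChart (A := A) b (chartAt (EuclideanSpace ℝ (Fin n)) x)
    (IsManifold.chart_mem_maximalAtlas x)
  have : ∀ x : M, SecondCountableTopology (E x).source :=
    fun x => (E x).secondCountableTopology_source
  have := hS.to_subtype
  refine TopologicalSpace.secondCountableTopology_of_countable_cover
    (U := fun x : S => (E x).source) (fun x => (E x).open_source) ?_
  refine Set.eq_univ_of_forall fun ζ => ?_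
  have : ζ.base ∈ ⋃ x ∈ S, (chartAt (EuclideanSpace ℝ (Fin n)) x).source := hSU ▸ Set.mem_univ _
  obtain ⟨x, hx, h⟩ := Set.mem_iUnion₂.1 this
  exact Set.mem_iUnion.2 ⟨⟨x, hx⟩, h⟩

section LocalExpression

variable {N : Type*} [TopologicalSpace N] [ChartedSpace (EuclideanSpace ℝ (Fin n)) N]
  {ψ : OpenPartialHomeomorph N (EuclideanSpace ℝ (Fin n))}
  {e : OpenPartialHomeomorph (WeilBundle n M A) (EuclideanSpace ℝ (Fin n × κ))}
  {e' : OpenPartialHomeomorph (WeilBundle n N A) (EuclideanSpace ℝ (Fin n × κ))}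

theorem IsLift.realPoint_mem (hφ : φ ∈ IsManifold.maximalAtlas (𝓡 n) ∞ M) (he : IsLift b φ e)
    (he' : IsLift b' ψ e') (f : C^∞⟮𝓡 n, M; 𝓡 n, N⟯) {v : EuclideanSpace ℝ (Fin n × κ)}
    (hv : v ∈ e.target ∩ e.symm ⁻¹' (map f ⁻¹' e'.source)) :
    realPoint n A ((basisCoord n b).symm v) ∈ φ.target ∩ φ.symm ⁻¹' (f ⁻¹' ψ.source) := by
  have hs := he.base_symm_mem hv.1
  rw [← he.coordPoint_symm hv.1, realPoint_coordPoint hφ hs]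
  refine ⟨φ.map_source hs, ?_⟩
  rw [Set.mem_preimage, φ.left_inv hs]
  have := hv.2
  rw [Set.mem_preimage, he'.1] at this
  exact this

variable [T2Space N] [IsManifold (𝓡 n) ∞ N]

/-- In the real coordinates, `f^A` is the prolongation of the local expression of `f`. -/
theorem IsLift.eqOn_prolongMap (hφ : φ ∈ IsManifold.maximalAtlas (𝓡 n) ∞ M)
    (hψ : ψ ∈ IsManifold.maximalAtlas (𝓡 n) ∞ N) (he : IsLift b φ e) (he' : IsLift b' ψ e')
    (f : C^∞⟮𝓡 n, M; 𝓡 n, N⟯) :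
    Set.EqOn (e' ∘ map f ∘ e.symm)
      (basisCoord n b' ∘ prolongMap (ψ ∘ f ∘ φ.symm) ∘ (basisCoord n b).symm)
      (e.target ∩ e.symm ⁻¹' (map f ⁻¹' e'.source)) := by
  intro v hv
  have hf : f (e.symm v).base ∈ ψ.source := by
    have := hv.2
    rw [Set.mem_preimage, he'.1] at this
    exact this
  simp only [Function.comp_apply]
  rw [he'.2 hv.2, coord_eq, coordPoint_map hφ hψ f (he.base_symm_mem hv.1) hf,
    he.coordPoint_symm hv.1]
  rfl

theorem IsLift.contDiffOn_map (hφ : φ ∈ IsManifold.maximalAtlas (𝓡 n) ∞ M)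
    (hψ : ψ ∈ IsManifold.maximalAtlas (𝓡 n) ∞ N) (he : IsLift b φ e) (he' : IsLift b' ψ e')
    (f : C^∞⟮𝓡 n, M; 𝓡 n, N⟯)
    (hf : ContDiffOn ℝ ∞ (ψ ∘ f ∘ φ.symm) (φ.target ∩ φ.symm ⁻¹' (f ⁻¹' ψ.source))) :
    ContDiffOn ℝ ∞ (e' ∘ map f ∘ e.symm) (e.target ∩ e.symm ⁻¹' (map f ⁻¹' e'.source)) := by
  refine ContDiffOn.congr ?_ (he.eqOn_prolongMap hφ hψ he' f)
  have hW := φ.isOpen_inter_preimage_symm (ψ.open_source.preimage f.contMDiff.continuous)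
  exact (basisCoord n b').toLinearMap.toContinuousLinearMap.contDiff.comp_contDiffOn
    ((contDiffOn_prolongMap (A := A) hW hf).comp
      (basisCoord n b).symm.toLinearMap.toContinuousLinearMap.contDiff.contDiffOn
      fun v hv => he.realPoint_mem hφ he' f hv)

theorem IsLift.isPositiveInCharts_map [DecidableEq κ]
    (hφ : φ ∈ IsManifold.maximalAtlas (𝓡 n) ∞ M)
    (hψ : ψ ∈ IsManifold.maximalAtlas (𝓡 n) ∞ N) (he : IsLift b φ e) (he' : IsLift b' ψ e')
    (hb : 0 < b.det b' ^ n) (f : C^∞⟮𝓡 n, M; 𝓡 n, N⟯) (hf : IsPositiveInCharts φ f ψ) :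
    IsPositiveInCharts e (map f) e' := by
  refine ⟨he.contDiffOn_map hφ hψ he' f hf.1, fun v hv => ?_⟩
  have hW := φ.isOpen_inter_preimage_symm (ψ.open_source.preimage f.contMDiff.continuous)
  have hv' := he.realPoint_mem hφ he' f hv
  have hF := hf.1.contDiffAt (hW.mem_nhds hv')
  have hD := e.isOpen_inter_preimage_symm (e'.open_source.preimage (continuous_map f))
  have h1 := ((he.eqOn_prolongMap hφ hψ he' f).eventuallyEq_of_mem (hD.mem_nhds hv)).fderiv_eq
    (𝕜 := ℝ)
  have h2 := (hasFDerivAt_prolongMap (A := A) hF).differentiableAt.hasFDerivAt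
  have h3 : HasFDerivAt (basisCoord n b' ∘ prolongMap (ψ ∘ f ∘ φ.symm) ∘ (basisCoord n b).symm) _ v :=
    (basisCoord n b').toLinearMap.toContinuousLinearMap.hasFDerivAt.comp v
      (h2.comp v (basisCoord n b).symm.toLinearMap.toContinuousLinearMap.hasFDerivAt)
  rw [h1, h3.fderiv]
  have h4 := det_fderiv_prolongMap_pos (A := A) hF (hf.2 _ hv')
  set D := fderiv ℝ (prolongMap (A := A) (ψ ∘ f ∘ φ.symm)) ((basisCoord n b).symm v)
  change 0 < LinearMap.det ((basisCoord n b').toLinearMap ∘ₗ (D : (Fin n → A) →ₗ[ℝ] (Fin n → A)) ∘ₗ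
    (basisCoord n b).symm.toLinearMap)
  have h5 : (basisCoord n b').toLinearMap ∘ₗ (D : (Fin n → A) →ₗ[ℝ] (Fin n → A)) ∘ₗ
      (basisCoord n b).symm.toLinearMap =
      ((basisCoord n b').toLinearMap ∘ₗ (basisCoord n b).symm.toLinearMap) ∘ₗ
      ((basisCoord n b).toLinearMap ∘ₗ (D : (Fin n → A) →ₗ[ℝ] (Fin n → A)) ∘ₗ
        (basisCoord n b).symm.toLinearMap) := by
    refine LinearMap.ext fun v => ?_
    simp only [LinearMap.comp_apply, LinearEquiv.coe_coe, LinearEquiv.symm_apply_apply]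
  rw [h5, LinearMap.det_comp, LinearMap.det_conj]
  exact mul_pos (det_basisCoord_comp_symm_pos b b' hb) h4

end LocalExpression

/-- The Weil bundle as a manifold: its atlas consists of the charts `φ^A`. -/
noncomputable abbrev chartedSpace (M : Type*) [TopologicalSpace M]
    [ChartedSpace (EuclideanSpace ℝ (Fin n)) M] [T2Space M] [IsManifold (𝓡 n) ∞ M]
    (b : Module.Basis κ ℝ A) :
    ChartedSpace (EuclideanSpace ℝ (Fin n × κ)) (WeilBundle n M A) where
  atlas := lifts b (IsManifold.maximalAtlas (𝓡 n) ∞ M)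
  chartAt ζ := liftChart b (chartAt _ ζ.base) (IsManifold.chart_mem_maximalAtlas ζ.base)
  mem_chart_source ζ := mem_chart_source _ ζ.base
  chart_mem_atlas ζ := ⟨_, IsManifold.chart_mem_maximalAtlas ζ.base, isLift_liftChart b _⟩

theorem isManifold (b : Module.Basis κ ℝ A) :
    letI := chartedSpace (n := n) M b
    IsManifold 𝓘(ℝ, EuclideanSpace ℝ (Fin n × κ)) ∞ (WeilBundle n M A) := by
  let := chartedSpace (n := n) M b
  refine isManifold_of_contDiffOn _ _ _ fun e e' ⟨φ, hφ, he⟩ ⟨ψ, hψ, he'⟩ => ?_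
  have := he.contDiffOn_map hφ hψ he' ContMDiffMap.id (contDiffOn_chart_change hφ hψ)
  rw [map_id] at this
  simpa using this

end WeilBundle

/-! ### The orientation of the Weil bundle -/

theorem theoremE {n : ℕ} {M : Type*} [TopologicalSpace M] [T2Space M] [SecondCountableTopology M]
    [ChartedSpace (EuclideanSpace ℝ (Fin n)) M] [IsManifold (𝓡 n) ∞ M]
    (o : SmoothOrientation (Fin n) M)
    {A : Type*} [CommRing A] [Algebra ℝ A] [WeilAlgebra A]
    {κ : Type*} [Fintype κ] [DecidableEq κ] (b : Module.Basis κ ℝ A) :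
    -- the charts `φ^A` exist, and make `M^A` a smooth manifold
    T2Space (WeilBundle n M A) ∧ SecondCountableTopology (WeilBundle n M A) ∧
    (∀ φ ∈ IsManifold.maximalAtlas (𝓡 n) ∞ M,
      ∃ e : OpenPartialHomeomorph (WeilBundle n M A) (EuclideanSpace ℝ (Fin n × κ)),
        WeilBundle.IsLift b φ e) ∧
    (∃ cs : ChartedSpace (EuclideanSpace ℝ (Fin n × κ)) (WeilBundle n M A),
      cs.atlas = WeilBundle.lifts b (IsManifold.maximalAtlas (𝓡 n) ∞ M) ∧
      IsManifold 𝓘(ℝ, EuclideanSpace ℝ (Fin n × κ)) ∞ (WeilBundle n M A) ∧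
      -- `M^A` has exactly one orientation for which `φ^A` is positive whenever `φ` is positive
      ∃! O : SmoothOrientation (Fin n × κ) (WeilBundle n M A),
        WeilBundle.lifts b o.charts ⊆ O.charts) ∧
    -- this orientation depends on the basis through the induced orientation of `A^n` only
    (∀ b' : Module.Basis κ ℝ A, 0 < b.det b' ^ n →
      ∀ e ∈ WeilBundle.lifts (n := n) (M := M) b o.charts,
      ∀ e' ∈ WeilBundle.lifts (n := n) (M := M) b' o.charts,
        IsPositiveInCharts e id e') ∧
    -- it is natural with respect to orientation-preserving smooth maps
    (∀ (N : Type*) [TopologicalSpace N] [T2Space N] [SecondCountableTopology N]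
      [ChartedSpace (EuclideanSpace ℝ (Fin n)) N] [IsManifold (𝓡 n) ∞ N]
      (o' : SmoothOrientation (Fin n) N) (f : C^∞⟮𝓡 n, M; 𝓡 n, N⟯),
      (∀ φ ∈ o.charts, ∀ ψ ∈ o'.charts, IsPositiveInCharts φ f ψ) →
      ∀ e ∈ WeilBundle.lifts b o.charts, ∀ e' ∈ WeilBundle.lifts b o'.charts,
        IsPositiveInCharts e (WeilBundle.map (A := A) f) e') := by
  -- differential calculus on `A` needs a norm, which is compatible with the given algebra structure
  have : Module.Finite ℝ A := WeilAlgebra.finite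
  obtain ⟨nc, rfl, hnorm⟩ := WeilAlgebra.exists_normedCommRing A
  obtain ⟨na, rfl⟩ : ∃ na : NormedAlgebra ℝ A, na.toAlgebra = ‹Algebra ℝ A› :=
    ⟨{ ‹Algebra ℝ A› with norm_smul_le := hnorm }, rfl⟩
  have hmax := o.subset_maximalAtlas
  have hself : 0 < b.det b ^ n := by simp [b.det_self]
  refine ⟨WeilBundle.t2Space, WeilBundle.secondCountableTopology b,
    fun φ hφ => ⟨WeilBundle.liftChart b φ hφ, WeilBundle.isLift_liftChart b hφ⟩,
    ⟨WeilBundle.chartedSpace M b, rfl, WeilBundle.isManifold b, ?_⟩, ?_, ?_⟩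
  · let := WeilBundle.chartedSpace (n := n) M b
    have := WeilBundle.isManifold (n := n) (M := M) b
    refine SmoothOrientation.existsUnique_of_cover ?_ ?_ ?_
    · rintro e ⟨φ, hφ, he⟩
      exact IsManifold.subset_maximalAtlas ⟨φ, hmax hφ, he⟩
    · intro ζ
      obtain ⟨φ, hφ, hζ⟩ := o.cover ζ.base
      exact ⟨_, ⟨φ, hφ, WeilBundle.isLift_liftChart b (hmax hφ)⟩, hζ⟩
    · rintro e ⟨φ, hφ, he⟩ e' ⟨ψ, hψ, he'⟩
      exact he.isPositiveInCharts_map (hmax hφ) (hmax hψ) he' hself ContMDiffMap.id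
        (o.positive φ hφ ψ hψ)
  · rintro b' hb e ⟨φ, hφ, he⟩ e' ⟨ψ, hψ, he'⟩
    exact he.isPositiveInCharts_map (hmax hφ) (hmax hψ) he' hb ContMDiffMap.id
      (o.positive φ hφ ψ hψ)
  · rintro N _ _ _ _ _ o' f hf e ⟨φ, hφ, he⟩ e' ⟨ψ, hψ, he'⟩
    exact he.isPositiveInCharts_map (hmax hφ) (o'.subset_maximalAtlas hψ) he' hself f
      (hf φ hφ ψ hψ)
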